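/- All graphs are finite and simple. Two distinct vertices of a graph are true twins if they have the same closed neighbourhood, and a graph is reduced if it has no true twins. A proper circular-arc graph (respectively, proper interval graph) is the intersection graph of a family of arcs of a circle (respectively, intervals of a line) in which no member is properly contained in another. The clique covering number $cc(G)$ is the least number of cliques of $G$ that together cover $V(G)$. A graph is perfect if each of its induced subgraphs has chromatic number equal to its clique number. A graph is locally complete 2-edge-colourable if its edges can be coloured with two colours (not necessarily properly) so that, for every vertex $x$ and each colour, the vertices joined to $x$ by edges of that colour induce a complete subgraph. A round ordering of $G$ is a circular ordering $v_1,\dots,v_n$ of $V(G)$ (subscripts modulo $n$) such that for each $i$ there are integers $\ell,\gamma\ge 0$ with $N[v_i]=\{v_{i-\ell},\dots,v_{i-1},v_i,v_{i+1},\dots,v_{i+\gamma}\}$; with respect to such an ordering, $v_i$ is a pseudo-cutvertex if $v_{i-1}$ and $v_{i+1}$ are not adjacent. Let $F_1,F_2,F_3$ be the graphs on the vertices $1,\dots,7$ consisting of the path $1\,2\,3\,4\,5\,6\,7$ together with the following additional edges: \[ F_1:\ 24,35,46;\qquad F_2:\ 13,24,35,46,57;\qquad F_3:\ 13,24,35,46,57,25,36.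 \] **Theorem.** Let $G$ be a reduced proper circular-arc graph with $cc(G)\ge 3$ that is not a proper interval graph, and let $v_1,\dots,v_n$ be a round ordering of $G$. Suppose that no $v_i$ is a pseudo-cutvertex and that $G$ is perfect. Then $G$ is locally complete 2-edge-colourable if and only if it contains none of $F_1,F_2,F_3$ as an induced subgraph. -/

import Mathlib

namespace SimpleGraph

/-- The closed neighbourhood `N[x]`. -/
def closedNbhd {V : Type*} (G : SimpleGraph V) (x : V) : Set V :=
  insert x (G.neighborSet x)

/-- `G` is reduced: it has no true twins, i.e. no two distinct vertices with the same closed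
neighbourhood. -/
def IsReduced {V : Type*} (G : SimpleGraph V) : Prop :=
  ∀ x y : V, G.closedNbhd x = G.closedNbhd y → x = y

/-- The family of sets `A` represents `G` as its intersection graph: two distinct vertices are
adjacent exactly when their sets meet. -/
def IsIntersectionModel {V X : Type*} (G : SimpleGraph V) (A : V → Set X) : Prop :=
  ∀ x y : V, x ≠ y → (G.Adj x y ↔ (A x ∩ A y).Nonempty)

/-- A (closed, non-degenerate) arc of the circle `ℝ / ℤ`. -/
def IsCircleArc (S : Set (AddCircle (1 : ℝ))) : Prop :=
  ∃ a b : ℝ, a < b ∧ b < a + 1 ∧ S = (fun t : ℝ => (t : AddCircle (1 : ℝ))) '' Set.Icc a b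

/-- `G` is the intersection graph of a family of arcs of a circle, no arc of the family being
properly contained in another. -/
def IsProperCircularArc {V : Type*} (G : SimpleGraph V) : Prop :=
  ∃ A : V → Set (AddCircle (1 : ℝ)),
    (∀ x, IsCircleArc (A x)) ∧ (∀ x y, ¬ A x ⊂ A y) ∧ G.IsIntersectionModel A

/-- `G` is the intersection graph of a family of (closed, non-degenerate) intervals of the line,
no interval of the family being properly contained in another. -/
def IsProperInterval {V : Type*} (G : SimpleGraph V) : Prop :=
  ∃ A : V → Set ℝ,
    (∀ x, ∃ a b : ℝ, a < b ∧ A x = Set.Icc a b) ∧ (∀ x y, ¬ A x ⊂ A y) ∧ G.IsIntersectionModel A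

/-- The clique covering number `cc(G)`: the least `k` such that the vertices of `G` can be covered
by `k` cliques. For finite `G` such a `k` exists, so the infimum is attained. -/
noncomputable def cliqueCoverNum {V : Type*} (G : SimpleGraph V) : ℕ :=
  sInf {k : ℕ | ∃ C : Fin k → Set V, (∀ i, G.IsClique (C i)) ∧ ∀ x, ∃ i, x ∈ C i}

/-- `G` is perfect: chromatic number and clique number agree for every induced subgraph. -/
def IsPerfect {V : Type*} (G : SimpleGraph V) : Prop :=
  ∀ s : Set V, (G.induce s).chromaticNumber = ((G.induce s).cliqueNum : ℕ∞)

/-- `v₁, …, vₙ`, indexed modulo `n`, is a round ordering of `G`: every closed neighbourhood is of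
the form `N[vᵢ] = {v_{i-ℓ}, …, v_{i-1}, vᵢ, v_{i+1}, …, v_{i+γ}}` with `ℓ, γ ≥ 0`
depending on `i`. -/
def IsRoundOrdering {V : Type*} (G : SimpleGraph V) {n : ℕ} (v : ZMod n ≃ V) : Prop :=
  ∀ i : ZMod n, ∃ l r : ℕ,
    G.closedNbhd (v i) = {x | ∃ d : ℤ, -(l : ℤ) ≤ d ∧ d ≤ (r : ℤ) ∧ x = v (i + (d : ZMod n))}

/-- With respect to the round ordering `v`, the vertex `vᵢ` is a pseudo-cutvertex: its predecessor
and its successor are not adjacent. -/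
def IsPseudoCutvertex {V : Type*} (G : SimpleGraph V) {n : ℕ} (v : ZMod n ≃ V) (i : ZMod n) :
    Prop :=
  ¬ G.Adj (v (i - 1)) (v (i + 1))

/-- `G` has a 2-edge-colouring such that, for every vertex `x` and every colour `c`, the vertices
joined to `x` by edges of colour `c` induce a complete subgraph. -/
def IsLocallyCompleteTwoEdgeColourable {V : Type*} (G : SimpleGraph V) : Prop :=
  ∃ φ : G.EdgeLabeling (Fin 2), ∀ (x : V) (c : Fin 2),
    G.IsClique ((φ.labelGraph c).neighborSet x)

/-- The graph `F₁`; the vertices `1, …, 7` are renamed `0, …, 6`. -/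
def graphF1 : SimpleGraph (Fin 7) :=
  fromEdgeSet {s(0, 1), s(1, 2), s(2, 3), s(3, 4), s(4, 5), s(5, 6),
    s(1, 3), s(2, 4), s(3, 5)}

/-- The graph `F₂`; the vertices `1, …, 7` are renamed `0, …, 6`. -/
def graphF2 : SimpleGraph (Fin 7) :=
  fromEdgeSet {s(0, 1), s(1, 2), s(2, 3), s(3, 4), s(4, 5), s(5, 6),
    s(0, 2), s(1, 3), s(2, 4), s(3, 5), s(4, 6)}

/-- The graph `F₃`; the vertices `1, …, 7` are renamed `0, …, 6`. -/
def graphF3 : SimpleGraph (Fin 7) :=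
  fromEdgeSet {s(0, 1), s(1, 2), s(2, 3), s(3, 4), s(4, 5), s(5, 6),
    s(0, 2), s(1, 3), s(2, 4), s(3, 5), s(4, 6), s(1, 4), s(2, 5)}

end SimpleGraph

/-!
# Locally complete 2-edge-colourings of round perfect graphs

Each of `F₁`, `F₂`, `F₃` has a closed chain of oddly many edges in which consecutive edges form an
induced path; such edges must receive different colours, so none of the three graphs is locally
complete 2-edge-colourable, and the property passes to induced subgraphs.

For the converse, the round ordering is unrolled to an `n`-periodic sequence of positions
indexed by `ℤ`.  Let `F i` be the first position after `i` whose vertex is not adjacent to that of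
`i` (`SimpleGraph.IsReach`).  Perfection and `cc(G) ≥ 3` give three independent vertices
(`IsPerfect.exists_indep_triple`); together with the absence of claws they force `F` to be monotone
and to determine adjacency (`IsRoundOrdering.exists_isReach`).  Perfection further yields an orbit
of `F` that closes up after one turn, `F^k a = a + n` with `k ≥ 3` (`IsReach.exists_periodic`).  The
circle is thereby cut into `k` blocks `[b, F b)`, each a clique.  Colour the edges inside blocks
with one colour and the edges between blocks with the other.  This is locally complete as soon as no
vertex has neighbours in both of the blocks adjacent to its own.

Such a vertex exists only if two vertices in the final groups of consecutive blocks are adjacent,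
the final group consisting of the vertices that are adjacent to the first vertex of the next block.
One member of each final group, joined directly or through the first vertex of the next block, gives
an induced cycle of length `2 k - d`, where `d` counts the direct transitions.  So `d` is even
unless the cycle is a triangle (`IsReach.sum_direct_eq_zero`).  If there are no such triangles, this
parity condition and reducedness exclude every direct transition (`IsReach.reach_le_of_no_triangle`).  If
there are, then `k = 3`; excluding `F₂` and `F₃` restricts the adjacencies between consecutive final
groups so much that reducedness and parity contradict each other (`IsReach.false_of_triangle`).
-/

namespace SimpleGraph

/-! ### Proper circular-arc graphs are claw-free -/

theorem addCircle_coe_eq_coe_iff (x y : ℝ) :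
    (x : AddCircle (1 : ℝ)) = y ↔ ∃ m : ℤ, y + m = x := by
  rw [← sub_eq_zero, ← AddCircle.coe_sub, AddCircle.coe_eq_zero_iff]
  simp only [zsmul_eq_mul, mul_one]
  exact exists_congr fun m => ⟨fun h => by linarith, fun h => by linarith⟩

/-- An arc that meets `π [a, b]` without being properly contained in it contains one of its two
endpoints. -/
theorem IsCircleArc.endpoint_mem {a b : ℝ} (hab : a < b)
    {X : Set (AddCircle (1 : ℝ))} (hX : IsCircleArc X)
    (hmeet : (((fun t : ℝ => (t : AddCircle (1 : ℝ))) '' Set.Icc a b) ∩ X).Nonempty)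
    (hss : ¬ X ⊂ (fun t : ℝ => (t : AddCircle (1 : ℝ))) '' Set.Icc a b) :
    (a : AddCircle (1 : ℝ)) ∈ X ∨ (b : AddCircle (1 : ℝ)) ∈ X := by
  obtain ⟨c, d, hcd, -, rfl⟩ := hX
  obtain ⟨_, ⟨s, ⟨hs1, hs2⟩, rfl⟩, ⟨t, ⟨ht1, ht2⟩, hst⟩⟩ := hmeet
  obtain ⟨m, hm⟩ := (addCircle_coe_eq_coe_iff t s).1 hst
  by_contra! hcon
  obtain ⟨ha, hb'⟩ := hcon
  -- A translate of `[c, d]` by `-m` meets `[a, b]` and misses both endpoints.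
  have h1 : a < c - m := by
    by_contra! h
    exact ha ⟨a + m, ⟨by linarith, by linarith⟩, (addCircle_coe_eq_coe_iff _ _).2 ⟨m, rfl⟩⟩
  have h2 : d - m < b := by
    by_contra! h
    exact hb' ⟨b + m, ⟨by linarith, by linarith⟩, (addCircle_coe_eq_coe_iff _ _).2 ⟨m, rfl⟩⟩
  refine hss ⟨?_, fun hsub => ha (hsub ⟨a, ⟨le_rfl, hab.le⟩, rfl⟩)⟩
  rintro _ ⟨u, ⟨hu1, hu2⟩, rfl⟩
  exact ⟨u - m, ⟨by linarith, by linarith⟩,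
    (addCircle_coe_eq_coe_iff _ _).2 ⟨-m, by push_cast; ring⟩⟩

/-- Three neighbours of a vertex of a proper circular-arc graph are never pairwise non-adjacent:
two of the three arcs share an endpoint of the arc of that vertex. -/
theorem IsProperCircularArc.claw_free {V : Type*} {G : SimpleGraph V}
    (h : G.IsProperCircularArc) {x y₁ y₂ y₃ : V} (h₁ : G.Adj x y₁) (h₂ : G.Adj x y₂)
    (h₃ : G.Adj x y₃) (h₁₂ : y₁ ≠ y₂) (h₁₃ : y₁ ≠ y₃) (h₂₃ : y₂ ≠ y₃) :
    G.Adj y₁ y₂ ∨ G.Adj y₁ y₃ ∨ G.Adj y₂ y₃ := by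
  obtain ⟨A, harc, hprop, hmod⟩ := h
  obtain ⟨a, b, hab, -, hx⟩ := harc x
  have key : ∀ y, G.Adj x y → (a : AddCircle (1 : ℝ)) ∈ A y ∨ (b : AddCircle (1 : ℝ)) ∈ A y := by
    intro y hy
    refine (harc y).endpoint_mem hab ?_ ?_
    · rw [← hx]
      exact (hmod x y hy.ne).1 hy
    · rw [← hx]
      exact hprop y x
  rw [hmod _ _ h₁₂, hmod _ _ h₁₃, hmod _ _ h₂₃]
  rcases key _ h₁ with k₁ | k₁ <;> rcases key _ h₂ with k₂ | k₂ <;>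
    rcases key _ h₃ with k₃ | k₃
  · exact Or.inl ⟨_, k₁, k₂⟩
  · exact Or.inl ⟨_, k₁, k₂⟩
  · exact Or.inr (Or.inl ⟨_, k₁, k₃⟩)
  · exact Or.inr (Or.inr ⟨_, k₂, k₃⟩)
  · exact Or.inr (Or.inr ⟨_, k₂, k₃⟩)
  · exact Or.inr (Or.inl ⟨_, k₁, k₃⟩)
  · exact Or.inl ⟨_, k₁, k₂⟩
  · exact Or.inl ⟨_, k₁, k₂⟩

/-! ### Perfect graphs without three independent vertices -/

/-- Every set `S` of vertices of a perfect graph has a proper colouring whose number of colours is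
the size of some clique contained in `S`. -/
theorem IsPerfect.exists_coloring {V : Type*} [Finite V] {G : SimpleGraph V} (h : G.IsPerfect)
    (S : Set V) : ∃ (K : Finset V) (c : V → ℕ), (K : Set V) ⊆ S ∧ G.IsClique (K : Set V) ∧
      (∀ x ∈ S, c x < K.card) ∧ ∀ x ∈ S, ∀ y ∈ S, G.Adj x y → c x ≠ c y := by
  classical
  obtain ⟨t, ht⟩ := (G.induce S).exists_isNClique_cliqueNum
  obtain ⟨col⟩ := chromaticNumber_le_iff_colorable.1 (h S).le
  refine ⟨t.map (Function.Embedding.subtype _),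
    fun x => if hx : x ∈ S then (col ⟨x, hx⟩ : ℕ) else 0, ?_, ?_, ?_, ?_⟩
  · intro x hx
    simp only [Finset.coe_map, Function.Embedding.subtype_apply, Set.mem_image] at hx
    obtain ⟨y, -, rfl⟩ := hx
    exact y.2
  · intro x hx y hy hxy
    simp only [Finset.coe_map, Function.Embedding.subtype_apply, Set.mem_image] at hx hy
    obtain ⟨x, hx, rfl⟩ := hx
    obtain ⟨y, hy, rfl⟩ := hy
    exact ht.isClique hx hy (fun e => hxy (congrArg _ e))
  · intro x hx
    rw [Finset.card_map, ht.card_eq]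
    simp only [hx, dif_pos]
    exact (col ⟨x, hx⟩).2
  · intro x hx y hy hxy
    simp only [hx, hy, dif_pos]
    intro e
    exact col.valid (v := ⟨x, hx⟩) (w := ⟨y, hy⟩) hxy (Fin.ext e)

/-- A graph that is not 2-colourable contains an odd cycle, given here as an odd closed walk `f` of
length `L` without repetitions. -/
theorem exists_odd_cycle {V : Type*} {H : SimpleGraph V} (hH : ¬ H.Colorable 2) :
    ∃ (L : ℕ) (f : ℕ → V), Odd L ∧ f L = f 0 ∧ (∀ i < L, H.Adj (f i) (f (i + 1))) ∧
      ∀ i < L, ∀ j < L, f i = f j → i = j := by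
  classical
  have hex : ∃ L, ∃ f : ℕ → V, Odd L ∧ f L = f 0 ∧ ∀ i < L, H.Adj (f i) (f (i + 1)) := by
    rw [two_colorable_iff_forall_loop_even] at hH
    push Not at hH
    obtain ⟨u, w, hw⟩ := hH
    exact ⟨w.length, w.getVert, Nat.not_even_iff_odd.1 hw, by simp,
      fun i hi => w.adj_getVert_succ hi⟩
  obtain ⟨f, hodd, hcl, hadj⟩ := Nat.find_spec hex
  set L := Nat.find hex with hL
  have hmin : ∀ M < L, ¬ ∃ f : ℕ → V, Odd M ∧ f M = f 0 ∧ ∀ i < M, H.Adj (f i) (f (i + 1)) :=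
    fun M hM => Nat.find_min hex hM
  -- A repetition would split a shortest odd closed walk into two closed walks, one of them odd.
  have key : ∀ i j, i < j → j < L → f i ≠ f j := by
    intro i j hij hj he
    rcases Nat.even_or_odd (j - i) with hev | hod
    · refine hmin (L - (j - i)) (by omega)
        ⟨fun t => if t ≤ i then f t else f (t + (j - i)), ?_, ?_, ?_⟩
      · exact Nat.Odd.sub_even (by omega) hodd hev
      · simp only [Nat.zero_le, if_true]
        rw [if_neg (by omega), Nat.sub_add_cancel (by omega), hcl]
      · intro t ht
        rcases lt_trichotomy t i with h | h | h
        · simp only [h.le, Nat.succ_le_of_lt h, if_true]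
          exact hadj t (by omega)
        · subst h
          simp only [le_rfl, if_true]
          rw [if_neg (by omega), he, show t + 1 + (j - t) = j + 1 by omega]
          exact hadj j hj
        · simp only
          rw [if_neg (by omega), if_neg (by omega), show t + 1 + (j - i) = t + (j - i) + 1 by omega]
          exact hadj _ (by omega)
    · exact hmin (j - i) (by omega) ⟨fun t => f (i + t), hod, by
        simp only [add_zero]
        rw [show i + (j - i) = j by omega, he], fun t ht => hadj (i + t) (by omega)⟩
  refine ⟨L, f, hodd, hcl, hadj, fun i hi j hj he => ?_⟩
  by_contra hne
  rcases lt_or_gt_of_ne hne with h | h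
  · exact key i j h hj he
  · exact key j i h hi he.symm

/-- A perfect graph of clique covering number at least three has three pairwise non-adjacent
vertices.  Otherwise its complement, which has no triangle and is not bipartite, contains an odd
cycle of some length `L`; on these `L` vertices the graph has only cliques of size at most `L / 2`,
and the colour classes have size at most two. -/
theorem IsPerfect.exists_indep_triple {V : Type*} [Finite V] {G : SimpleGraph V}
    (h : G.IsPerfect) (hcc : 3 ≤ G.cliqueCoverNum) :
    ∃ x y z : V, x ≠ y ∧ x ≠ z ∧ y ≠ z ∧ ¬ G.Adj x y ∧ ¬ G.Adj x z ∧ ¬ G.Adj y z := by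
  classical
  have hnc : ¬ Gᶜ.Colorable 2 := by
    rintro ⟨col⟩
    have : G.cliqueCoverNum ≤ 2 := by
      refine Nat.sInf_le ⟨fun i => {x | col x = i}, fun i x hx y hy hxy => ?_,
        fun x => ⟨col x, rfl⟩⟩
      by_contra hn
      exact col.valid (show Gᶜ.Adj x y from ⟨hxy, hn⟩) (hx.trans hy.symm)
    omega
  by_contra! htri
  obtain ⟨L, f, hodd, hcl, hadj, hinj⟩ := exists_odd_cycle hnc
  set S : Finset V := (Finset.range L).image f with hS
  have hScard : S.card = L := by
    rw [hS, Finset.card_image_of_injOn, Finset.card_range]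
    intro i hi j hj he
    exact hinj i (by simpa using hi) j (by simpa using hj) he
  obtain ⟨K, c, hKS, hK, hcK, hc⟩ := h.exists_coloring (S : Set V)
  have h1 : L ≤ 2 * K.card := by
    rw [← hScard, ← Finset.card_range K.card]
    refine Finset.card_le_mul_card_image_of_maps_to (f := c)
      (fun x hx => Finset.mem_range.2 (hcK x hx)) 2 fun b _ => ?_
    by_contra! hlt
    obtain ⟨x, hx, y, hy, z, hz, hxy, hxz, hyz⟩ := Finset.two_lt_card.1 hlt
    simp only [Finset.mem_filter] at hx hy hz
    exact hc y hy.1 z hz.1 (htri x y z hxy hxz hyz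
      (fun e => hc x hx.1 y hy.1 e (hx.2.trans hy.2.symm))
      (fun e => hc x hx.1 z hz.1 e (hx.2.trans hz.2.symm))) (hy.2.trans hz.2.symm)
  -- The index set of `K` and its cyclic shift are disjoint.
  set I := (Finset.range L).filter (fun i => f i ∈ K) with hI
  set J := (Finset.range L).filter (fun i => f (i + 1) ∈ K) with hJ
  have hcI : K.card ≤ I.card := by
    have : K ⊆ I.image f := by
      intro x hx
      obtain ⟨i, hi, rfl⟩ := Finset.mem_image.1 (hKS hx)
      exact Finset.mem_image_of_mem _ (Finset.mem_filter.2 ⟨hi, hx⟩)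
    exact (Finset.card_le_card this).trans Finset.card_image_le
  have hcJ : K.card ≤ J.card := by
    have : K ⊆ J.image (fun i => f (i + 1)) := by
      intro x hx
      obtain ⟨i, hi, rfl⟩ := Finset.mem_image.1 (hKS hx)
      rw [Finset.mem_range] at hi
      rcases Nat.eq_zero_or_pos i with rfl | hpos
      · refine Finset.mem_image.2
          ⟨L - 1, Finset.mem_filter.2 ⟨Finset.mem_range.2 (by omega), ?_⟩, ?_⟩
        · rw [Nat.sub_add_cancel (by omega), hcl]
          exact hx
        · rw [Nat.sub_add_cancel (by omega), hcl]
      · refine Finset.mem_image.2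
          ⟨i - 1, Finset.mem_filter.2 ⟨Finset.mem_range.2 (by omega), ?_⟩, ?_⟩
        · rw [Nat.sub_add_cancel hpos]
          exact hx
        · rw [Nat.sub_add_cancel hpos]
    exact (Finset.card_le_card this).trans Finset.card_image_le
  have hdisj : Disjoint I J := by
    rw [Finset.disjoint_left]
    intro i hi hj
    simp only [hI, hJ, Finset.mem_filter, Finset.mem_range] at hi hj
    have := hadj i hi.1
    exact this.2 (hK hi.2 hj.2 this.1)
  have hsum : I.card + J.card ≤ L := by
    rw [← Finset.card_union_of_disjoint hdisj]
    refine (Finset.card_le_card ?_).trans (Finset.card_range L).le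
    exact Finset.union_subset (Finset.filter_subset _ _) (Finset.filter_subset _ _)
  obtain ⟨r, hr⟩ := hodd
  omega

/-! ### The reach function of a round ordering -/

theorem mem_closedNbhd {V : Type*} {G : SimpleGraph V} {x y : V} :
    y ∈ G.closedNbhd x ↔ y = x ∨ G.Adj x y := by
  simp [closedNbhd]

/-- The circular ordering `p` of the vertices of `G`, unrolled to an `n`-periodic sequence indexed
by the integers, together with the function `F` that sends a position `i` to the first position
after `i` whose vertex is not a neighbour of `p i`.  The fields say that the vertices at positions
`i < j < i + n` are adjacent exactly when one of them reaches the other clockwise, that no two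
clockwise reaches cover the circle, and that every reach has length at least two. -/
structure IsReach {V : Type*} (G : SimpleGraph V) (n : ℕ) (p : ℤ → V) (F : ℤ → ℤ) : Prop where
  surj : ∀ x, ∃ i, p i = x
  eq_iff : ∀ i j, p i = p j ↔ ∃ m : ℤ, i = j + m * n
  mono : Monotone F
  shift : ∀ i, F (i + n) = F i + n
  three_le : ∀ i, i + 3 ≤ F i
  reach_reach_lt : ∀ i, F (F i) < i + n
  adj_iff : ∀ i j : ℤ, i < j → j < i + n → (G.Adj (p i) (p j) ↔ j < F i ∨ i + n < F j)

/-- The trace on two positions `i`, `j` of a closed neighbourhood that contains both: it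
contains `[i, j]` or `[j, i + n]`. -/
theorem IsRoundOrdering.segment_subset {V : Type*} {G : SimpleGraph V} {n : ℕ} {v : ZMod n ≃ V}
    (hv : G.IsRoundOrdering v) (c : V) {i j : ℤ}
    (hi : v i ∈ G.closedNbhd c) (hj : v j ∈ G.closedNbhd c) :
    (∀ m : ℤ, i ≤ m → m ≤ j → v m ∈ G.closedNbhd c) ∨
      ∀ m : ℤ, j ≤ m → m ≤ i + n → v m ∈ G.closedNbhd c := by
  obtain ⟨k, rfl⟩ := v.surjective c
  obtain ⟨k, rfl⟩ := ZMod.intCast_surjective k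
  obtain ⟨l, r, hN⟩ := hv k
  rw [hN] at hi hj ⊢
  obtain ⟨d, hd1, hd2, hd⟩ := hi
  obtain ⟨e, he1, he2, he⟩ := hj
  have hd := v.injective hd
  have he := v.injective he
  rw [← Int.cast_add, ZMod.intCast_eq_intCast_iff_dvd_sub] at hd he
  obtain ⟨s, hs⟩ := hd
  obtain ⟨t, ht⟩ := he
  have hmem : ∀ m : ℤ, ∀ w : ℤ, k - l ≤ m + n * w → m + n * w ≤ k + r →
      v m ∈ {x | ∃ d : ℤ, -(l : ℤ) ≤ d ∧ d ≤ (r : ℤ) ∧ x = v ((k : ZMod n) + (d : ZMod n))} := by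
    intro m w h1 h2
    refine ⟨m + n * w - k, by linarith, by linarith, ?_⟩
    push_cast
    simp
  rcases le_or_gt s t with hst | hst
  · left
    intro m h1 h2
    have : (n : ℤ) * s ≤ n * t := mul_le_mul_of_nonneg_left hst (by positivity)
    exact hmem m s (by linarith) (by linarith)
  · right
    intro m h1 h2
    have : (n : ℤ) * (t + 1) ≤ n * s := mul_le_mul_of_nonneg_left hst (by positivity)
    exact hmem m t (by linarith) (by linarith)

/-- Every vertex occurs in each window of `n` consecutive positions. -/
theorem exists_lift {V : Type*} {n : ℕ} (hn : 0 < n) (v : ZMod n ≃ V) (i : ℤ) (x : V) :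
    ∃ m : ℤ, i ≤ m ∧ m < i + n ∧ v m = x := by
  obtain ⟨k, rfl⟩ := v.surjective x
  obtain ⟨k, rfl⟩ := ZMod.intCast_surjective k
  have hn' : (0 : ℤ) < n := by exact_mod_cast hn
  refine ⟨i + (k - i) % n, by linarith [Int.emod_nonneg (k - i) hn'.ne'],
    by linarith [Int.emod_lt_of_pos (k - i) hn'], ?_⟩
  congr 1
  rw [ZMod.intCast_eq_intCast_iff_dvd_sub]
  exact ⟨(k - i) / n, by linarith [Int.emod_add_mul_ediv (k - i) n]⟩

/-- In a proper circular-arc graph with three independent vertices, the closed neighbourhoods of the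
two adjacent vertices at positions `i` and `j` do not cover one each of the two segments of the
circle between `i` and `j`. Otherwise, as there are no claws, one independent vertex `P` would be
adjacent to the first only, one, `Q`, to the second only, and one, `C`, to both; but `N[C]` contains
one of the two segments, hence `P` or `Q`. -/
theorem IsRoundOrdering.not_opposite {V : Type*} {G : SimpleGraph V} {n : ℕ} {v : ZMod n ≃ V}
    (hv : G.IsRoundOrdering v) (hn : 0 < n) (hpca : G.IsProperCircularArc)
    (hT : ∃ x y z : V, x ≠ y ∧ x ≠ z ∧ y ≠ z ∧ ¬ G.Adj x y ∧ ¬ G.Adj x z ∧ ¬ G.Adj y z)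
    {i j : ℤ} {a b : V}
    (hab : a = v i ∧ b = v j ∨ a = v j ∧ b = v i) (hadj : G.Adj a b)
    (ha : ∀ m : ℤ, i ≤ m → m ≤ j → v m ∈ G.closedNbhd a)
    (hb : ∀ m : ℤ, j ≤ m → m ≤ i + n → v m ∈ G.closedNbhd b) : False := by
  have mid : ∀ P Q C : V, P ∉ G.closedNbhd b → Q ∉ G.closedNbhd a → G.Adj C a → G.Adj C b →
      P ∉ G.closedNbhd C → Q ∉ G.closedNbhd C → False := by
    intro P Q C hP hQ hCa hCb hPC hQC
    have hi : v i ∈ G.closedNbhd C := by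
      rw [mem_closedNbhd]
      rcases hab with ⟨rfl, rfl⟩ | ⟨rfl, rfl⟩
      · exact Or.inr hCa
      · exact Or.inr hCb
    have hj : v j ∈ G.closedNbhd C := by
      rw [mem_closedNbhd]
      rcases hab with ⟨rfl, rfl⟩ | ⟨rfl, rfl⟩
      · exact Or.inr hCb
      · exact Or.inr hCa
    obtain ⟨m, hm1, hm2, rfl⟩ := exists_lift hn v i P
    obtain ⟨m', hm'1, hm'2, rfl⟩ := exists_lift hn v i Q
    rcases hv.segment_subset C hi hj with h | h
    · by_cases hmj : m ≤ j
      · exact hPC (h m hm1 hmj)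
      · exact hP (hb m (by omega) hm2.le)
    · by_cases hmj : j ≤ m'
      · exact hQC (h m' hmj hm'2.le)
      · exact hQ (ha m' hm'1 (by omega))
  have cover : ∀ x, x = a ∨ G.Adj a x ∨ x = b ∨ G.Adj b x := by
    intro x
    obtain ⟨m, hm1, hm2, rfl⟩ := exists_lift hn v i x
    by_cases hmj : m ≤ j
    · have := mem_closedNbhd.1 (ha m hm1 hmj)
      tauto
    · have := mem_closedNbhd.1 (hb m (by omega) hm2.le)
      tauto
  have ne_a : ∀ x y z : V, x ≠ y → x ≠ z → y ≠ z → ¬ G.Adj x y → ¬ G.Adj x z → ¬ G.Adj y z →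
      x ≠ a := by
    rintro x y z hxy hxz hyz nxy nxz nyz rfl
    have hy : G.Adj b y := by
      rcases cover y with h | h | rfl | h
      exacts [absurd h.symm hxy, absurd h nxy, absurd hadj nxy, h]
    have hz : G.Adj b z := by
      rcases cover z with h | h | rfl | h
      exacts [absurd h.symm hxz, absurd h nxz, absurd hadj nxz, h]
    rcases hpca.claw_free hadj.symm hy hz hxy hxz hyz with h | h | h
    exacts [nxy h, nxz h, nyz h]
  have ne_b : ∀ x y z : V, x ≠ y → x ≠ z → y ≠ z → ¬ G.Adj x y → ¬ G.Adj x z → ¬ G.Adj y z →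
      x ≠ b := by
    rintro x y z hxy hxz hyz nxy nxz nyz rfl
    have hy : G.Adj a y := by
      rcases cover y with rfl | h | h | h
      exacts [absurd hadj.symm nxy, h, absurd h.symm hxy, absurd h nxy]
    have hz : G.Adj a z := by
      rcases cover z with rfl | h | h | h
      exacts [absurd hadj.symm nxz, h, absurd h.symm hxz, absurd h nxz]
    rcases hpca.claw_free hadj hy hz hxy hxz hyz with h | h | h
    exacts [nxy h, nxz h, nyz h]
  have two_a : ∀ x y : V, x ≠ y → ¬ G.Adj x y → x ≠ b → y ≠ b → G.Adj a x → G.Adj a y →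
      G.Adj b x ∨ G.Adj b y := by
    intro x y hxy nxy hxb hyb hx hy
    rcases hpca.claw_free hx hy hadj hxy hxb hyb with h | h | h
    exacts [absurd h nxy, Or.inl h.symm, Or.inr h.symm]
  have two_b : ∀ x y : V, x ≠ y → ¬ G.Adj x y → x ≠ a → y ≠ a → G.Adj b x → G.Adj b y →
      G.Adj a x ∨ G.Adj a y := by
    intro x y hxy nxy hxa hya hx hy
    rcases hpca.claw_free hx hy hadj.symm hxy hxa hya with h | h | h
    exacts [absurd h nxy, Or.inl h.symm, Or.inr h.symm]
  have mid' : ∀ P Q C : V, P ≠ C → Q ≠ C → P ≠ b → Q ≠ a → ¬ G.Adj P C → ¬ G.Adj Q C →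
      ¬ G.Adj b P → ¬ G.Adj a Q → G.Adj a C → G.Adj b C → False := by
    intro P Q C h1 h2 h3 h4 h5 h6 h7 h8 h9 h10
    refine mid P Q C ?_ ?_ h9.symm h10.symm ?_ ?_ <;> rw [mem_closedNbhd]
    · tauto
    · tauto
    · rintro (h | h)
      exacts [h1 h, h5 h.symm]
    · rintro (h | h)
      exacts [h2 h, h6 h.symm]
  obtain ⟨x, y, z, hxy, hxz, hyz, nxy, nxz, nyz⟩ := hT
  have nyx : ¬ G.Adj y x := fun h => nxy h.symm
  have nzx : ¬ G.Adj z x := fun h => nxz h.symm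
  have nzy : ¬ G.Adj z y := fun h => nyz h.symm
  have xa := ne_a x y z hxy hxz hyz nxy nxz nyz
  have ya := ne_a y x z hxy.symm hyz hxz nyx nyz nxz
  have za := ne_a z x y hxz.symm hyz.symm hxy nzx nzy nxy
  have xb := ne_b x y z hxy hxz hyz nxy nxz nyz
  have yb := ne_b y x z hxy.symm hyz hxz nyx nyz nxz
  have zb := ne_b z x y hxz.symm hyz.symm hxy nzx nzy nxy
  -- Each of the three is adjacent to `a` or `b`, and no two of them to just the same one.
  have clawa : G.Adj a x → G.Adj a y → ¬ G.Adj a z := fun h₁ h₂ h₃ => by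
    rcases hpca.claw_free h₁ h₂ h₃ hxy hxz hyz with h | h | h
    exacts [nxy h, nxz h, nyz h]
  have clawb : G.Adj b x → G.Adj b y → ¬ G.Adj b z := fun h₁ h₂ h₃ => by
    rcases hpca.claw_free h₁ h₂ h₃ hxy hxz hyz with h | h | h
    exacts [nxy h, nxz h, nyz h]
  have hx : G.Adj a x ∨ G.Adj b x := by have := cover x; tauto
  have hy : G.Adj a y ∨ G.Adj b y := by have := cover y; tauto
  have hz : G.Adj a z ∨ G.Adj b z := by have := cover z; tauto
  have a₁ := two_a x y hxy nxy xb yb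
  have a₂ := two_a x z hxz nxz xb zb
  have a₃ := two_a y z hyz nyz yb zb
  have b₁ := two_b x y hxy nxy xa ya
  have b₂ := two_b x z hxz nxz xa za
  have b₃ := two_b y z hyz nyz ya za
  have m₁ := mid' x y z hxz hyz xb ya nxz nyz
  have m₂ := mid' y x z hyz hxz yb xa nyz nxz
  have m₃ := mid' x z y hxy hyz.symm xb za nxy nzy
  have m₄ := mid' z x y hyz.symm hxy zb xa nzy nxy
  have m₅ := mid' y z x hxy.symm hxz.symm yb za nyx nzx
  have m₆ := mid' z y x hxz.symm hxy.symm zb ya nzx nyx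
  clear mid mid' cover ne_a ne_b two_a two_b ha hb hab
  grind

/-- A round ordering without pseudo-cutvertices of a proper circular-arc graph of clique covering
number at least three with three independent vertices has a reach function. -/
theorem IsRoundOrdering.exists_isReach {V : Type*} [Finite V] {G : SimpleGraph V} {n : ℕ}
    {v : ZMod n ≃ V} (hv : G.IsRoundOrdering v) (hpca : G.IsProperCircularArc)
    (hcc : 3 ≤ G.cliqueCoverNum)
    (hT : ∃ x y z : V, x ≠ y ∧ x ≠ z ∧ y ≠ z ∧ ¬ G.Adj x y ∧ ¬ G.Adj x z ∧ ¬ G.Adj y z)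
    (hpc : ∀ i : ZMod n, ¬ G.IsPseudoCutvertex v i) :
    ∃ (p : ℤ → V) (F : ℤ → ℤ), G.IsReach n p F := by
  classical
  have hn : 0 < n := by
    rcases Nat.eq_zero_or_pos n with rfl | h
    · have : Finite (ZMod 0) := Finite.of_equiv V v.symm
      exact absurd this (by change ¬ Finite ℤ; exact not_finite_iff_infinite.2 inferInstance)
    · exact h
  set p : ℤ → V := fun i => v i with hp
  have hn' : (0 : ℤ) < n := by exact_mod_cast hn
  have heq : ∀ i j, p i = p j ↔ ∃ m : ℤ, i = j + m * n := by
    intro i j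
    rw [hp, v.injective.eq_iff, eq_comm, ZMod.intCast_eq_intCast_iff_dvd_sub]
    exact exists_congr fun m => ⟨fun h => by linarith, fun h => by linarith⟩
  have hper : ∀ i, p (i + n) = p i := fun i => (heq _ _).2 ⟨1, by ring⟩
  have hne : ∀ i j : ℤ, i < j → j < i + n → p i ≠ p j := by
    intro i j hij hji he
    obtain ⟨m, hm⟩ := (heq i j).1 he
    have h1 : m < 0 := by by_contra! h; nlinarith
    have h2 : -1 < m := by by_contra! h; nlinarith
    omega
  have hex : ∀ i : ℤ, ∃ d : ℕ, 0 < d ∧ ¬ G.Adj (p i) (p (i + d)) :=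
    fun i => ⟨n, hn, by rw [hper]; exact G.irrefl⟩
  set F : ℤ → ℤ := fun i => i + (Nat.find (hex i) : ℕ) with hF
  have F_gt : ∀ i, i < F i := by
    intro i
    have := (Nat.find_spec (hex i)).1
    simp only [hF]
    omega
  have F_le : ∀ i, F i ≤ i + n := by
    intro i
    have := Nat.find_min' (hex i) ⟨hn, by rw [hper]; exact G.irrefl⟩
    simp only [hF]
    omega
  have F_not : ∀ i, ¬ G.Adj (p i) (p (F i)) := fun i => (Nat.find_spec (hex i)).2
  have F_adj : ∀ i m, i < m → m < F i → G.Adj (p i) (p m) := by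
    intro i m him hm
    by_contra hcon
    have := Nat.find_min' (hex i) (m := (m - i).toNat) ⟨by omega, by
      rw [show i + ((m - i).toNat : ℤ) = m by omega]; exact hcon⟩
    simp only [hF] at hm
    omega
  have mem_self : ∀ x, x ∈ G.closedNbhd x := fun x => mem_closedNbhd.2 (Or.inl rfl)
  have seg : ∀ i j : ℤ, i < j → (∀ m : ℤ, i ≤ m → m ≤ j → p m ∈ G.closedNbhd (p i)) →
      j < i + n → j < F i := by
    intro i j hij h hlt
    by_contra! hcon
    rcases mem_closedNbhd.1 (h (F i) (F_gt i).le hcon) with h1 | h1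
    · exact hne i (F i) (F_gt i) (by omega) h1.symm
    · exact F_not i h1
  have hadj : ∀ i j : ℤ, i < j → j < i + n → (G.Adj (p i) (p j) ↔ j < F i ∨ i + n < F j) := by
    intro i j hij hji
    constructor
    · intro h
      have hji' : p j ∈ G.closedNbhd (p i) := mem_closedNbhd.2 (Or.inr h)
      have hij' : p i ∈ G.closedNbhd (p j) := mem_closedNbhd.2 (Or.inr h.symm)
      rcases hv.segment_subset (p i) (mem_self _) hji' with h1 | h1
      · exact Or.inl (seg i j hij h1 hji)
      rcases hv.segment_subset (p j) hij' (mem_self _) with h2 | h2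
      · exact (hv.not_opposite hn hpca hT (Or.inr ⟨rfl, rfl⟩) h.symm h2 h1).elim
      · exact Or.inr (seg j (i + n) hji h2 (by omega))
    · rintro (h | h)
      · exact F_adj i j hij h
      · rw [← hper i]
        exact (F_adj j (i + n) hji h).symm
  have F_mono : Monotone F := by
    intro i j hle
    rcases hle.eq_or_lt with rfl | hij
    · exact le_rfl
    by_contra! hcon
    have hj := F_gt j
    have hi := F_le i
    have h1 : ∀ m : ℤ, i ≤ m → m ≤ F j → p m ∈ G.closedNbhd (p i) := by
      intro m h1 h2
      rcases h1.eq_or_lt with rfl | h1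
      · exact mem_self _
      · exact mem_closedNbhd.2 (Or.inr (F_adj i m h1 (by omega)))
    have hadj' : G.Adj (p i) (p (F j)) := F_adj i _ (by omega) hcon
    rcases hv.segment_subset (p (F j)) (i := i) (j := F j)
      (mem_closedNbhd.2 (Or.inr hadj'.symm)) (mem_self _) with h2 | h2
    · rcases mem_closedNbhd.1 (h2 j hij.le hj.le) with h3 | h3
      · exact hne j (F j) hj (by omega) h3
      · exact F_not j h3.symm
    · exact hv.not_opposite hn hpca hT (Or.inl ⟨rfl, rfl⟩) hadj' h1 h2
  have hlt : ∀ i, F (F i) < i + n := by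
    intro i
    by_contra! hcon
    have hcl : ∀ i, G.IsClique (p '' Set.Ico i (F i)) := by
      rintro i _ ⟨x, ⟨hx1, hx2⟩, rfl⟩ _ ⟨y, ⟨hy1, hy2⟩, rfl⟩ hxy
      rcases lt_trichotomy x y with h | rfl | h
      · exact F_adj x y h (hy2.trans_le (F_mono hx1))
      · exact absurd rfl hxy
      · exact (F_adj y x h (hx2.trans_le (F_mono hy1))).symm
    have : G.cliqueCoverNum ≤ 2 := by
      refine Nat.sInf_le ⟨![p '' Set.Ico i (F i), p '' Set.Ico (F i) (F (F i))], ?_, ?_⟩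
      · intro t
        fin_cases t
        · exact hcl i
        · exact hcl (F i)
      · intro x
        obtain ⟨m, hm1, hm2, rfl⟩ := exists_lift hn v i x
        by_cases h : m < F i
        · exact ⟨0, m, ⟨hm1, h⟩, rfl⟩
        · exact ⟨1, m, ⟨by omega, by omega⟩, rfl⟩
    omega
  refine ⟨p, F, fun x => ?_, heq, F_mono, fun i => ?_, fun i => ?_, hlt, hadj⟩
  · obtain ⟨m, -, -, hm⟩ := exists_lift hn v 0 x
    exact ⟨m, hm⟩
  · have hiff : ∀ d : ℕ, (0 < d ∧ ¬ G.Adj (p (i + n)) (p (i + n + d))) ↔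
        (0 < d ∧ ¬ G.Adj (p i) (p (i + d))) := by
      intro d
      rw [hper, show i + n + d = i + d + n by ring, hper]
    have : Nat.find (hex (i + n)) = Nat.find (hex i) :=
      le_antisymm (Nat.find_min' _ ((hiff _).2 (Nat.find_spec (hex i))))
        (Nat.find_min' _ ((hiff _).1 (Nat.find_spec (hex (i + n)))))
    simp only [hF, this]
    ring
  · have h1 := F_gt i
    have h2 := F_gt (F i)
    have h3 := hlt i
    have h4 := hlt (i + 1)
    have h5 := F_mono (show i + 2 ≤ F (i + 1) by have := F_gt (i + 1); omega)
    have h6 : G.Adj (p i) (p (i + 2)) := by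
      have h := hpc ((i + 1 : ℤ) : ZMod n)
      have e₁ : ((i + 1 : ℤ) : ZMod n) - 1 = (i : ℤ) := by push_cast; ring
      have e₂ : ((i + 1 : ℤ) : ZMod n) + 1 = (i + 2 : ℤ) := by push_cast; ring
      rw [IsPseudoCutvertex, not_not, e₁, e₂] at h
      exact h
    rcases (hadj i (i + 2) (by omega) (by omega)).1 h6 with h | h <;> omega

namespace IsReach

variable {V : Type*} {G : SimpleGraph V} {n : ℕ} {p : ℤ → V} {F : ℤ → ℤ}

theorem n_pos (h : G.IsReach n p F) : (0 : ℤ) < n := by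
  have h1 := h.three_le 0
  have h2 := h.three_le (F 0)
  have h3 := h.reach_reach_lt 0
  omega

theorem lt_reach (h : G.IsReach n p F) (i : ℤ) : i < F i := by
  have := h.three_le i
  omega

theorem reach_lt (h : G.IsReach n p F) (i : ℤ) : F i < i + n := by
  have h1 := h.lt_reach (F i)
  have h2 := h.reach_reach_lt i
  omega

theorem adj_of_lt (h : G.IsReach n p F) {i j : ℤ} (hij : i < j) (hj : j < F i) :
    G.Adj (p i) (p j) :=
  (h.adj_iff i j hij (by have := h.reach_lt i; omega)).2 (Or.inl hj)

theorem shift_mul (h : G.IsReach n p F) (i m : ℤ) : F (i + m * n) = F i + m * n := by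
  induction m using Int.induction_on with
  | zero => simp
  | succ m ih =>
    rw [show i + ((m : ℤ) + 1) * n = i + m * n + n by ring, h.shift, ih]
    ring
  | pred m ih =>
    have := h.shift (i + (-(m : ℤ) - 1) * n)
    rw [show i + (-(m : ℤ) - 1) * n + n = i + -(m : ℤ) * n by ring, ih] at this
    linarith

theorem iterate_shift (h : G.IsReach n p F) (t : ℕ) (i m : ℤ) :
    F^[t] (i + m * n) = F^[t] i + m * n := by
  induction t with
  | zero => rfl
  | succ t ih => rw [Function.iterate_succ_apply', ih, h.shift_mul, Function.iterate_succ_apply']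

theorem vertex_shift (h : G.IsReach n p F) (i m : ℤ) : p (i + m * n) = p i :=
  (h.eq_iff _ _).2 ⟨m, rfl⟩

theorem ne_of_lt (h : G.IsReach n p F) {i j : ℤ} (hij : i < j) (hj : j < i + n) : p i ≠ p j := by
  intro he
  obtain ⟨m, hm⟩ := (h.eq_iff i j).1 he
  have hn := h.n_pos
  have h1 : m < 0 := by by_contra! h; nlinarith
  have h2 : -1 < m := by by_contra! h; nlinarith
  omega

theorem exists_lift (h : G.IsReach n p F) (b : ℤ) (x : V) : ∃ i, b ≤ i ∧ i < b + n ∧ p i = x := by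
  obtain ⟨k, rfl⟩ := h.surj x
  have hn := h.n_pos
  refine ⟨b + (k - b) % n, by linarith [Int.emod_nonneg (k - b) hn.ne'],
    by linarith [Int.emod_lt_of_pos (k - b) hn], ?_⟩
  rw [h.eq_iff]
  exact ⟨-((k - b) / n), by linarith [Int.emod_add_mul_ediv (k - b) n]⟩

theorem le_iterate (h : G.IsReach n p F) (a : ℤ) (t : ℕ) : a + t ≤ F^[t] a := by
  induction t with
  | zero => simp
  | succ t ih =>
    rw [Function.iterate_succ_apply']
    have := h.lt_reach (F^[t] a)
    push_cast
    omega

/-! ### Perfection closes up an orbit of the reach function -/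

/-- If `G` is perfect, then some orbit of the reach function closes up after a single turn, so that
the circle is cut into `k` consecutive cliques `[Fᵗ a, Fᵗ⁺¹ a)`.

The positions `x` with `F^q x = x + P n`, for suitable `q` and `P`, form a set `O` on which `F` is
an order automorphism.  All windows `O ∩ [x, F x)` have the same number of elements, no clique on
`O` is larger, and so an optimal colouring of `O` is constant along the orbits of `F`.  If an orbit
did not close up after one turn, it would contain two adjacent positions. -/
theorem exists_periodic [Finite V] (h : G.IsReach n p F) (hperf : G.IsPerfect) :
    ∃ (a : ℤ) (k : ℕ), 3 ≤ k ∧ F^[k] a = a + n := by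
  classical
  have hn := h.n_pos
  obtain ⟨s, t, hst, he⟩ : ∃ s t : ℕ, s < t ∧ p (F^[t] 0) = p (F^[s] 0) := by
    obtain ⟨s, t, hne, he⟩ := Finite.exists_ne_map_eq_of_infinite (fun t : ℕ => p (F^[t] 0))
    rcases lt_or_gt_of_ne hne with hlt | hlt
    · exact ⟨s, t, hlt, he.symm⟩
    · exact ⟨t, s, hlt, he⟩
  obtain ⟨P, hP⟩ := (h.eq_iff _ _).1 he
  set a := F^[s] 0 with ha
  obtain ⟨q, rfl⟩ : ∃ q, t = q + 1 + s := ⟨t - s - 1, by omega⟩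
  rw [Function.iterate_add_apply, ← ha] at hP
  set O : Set ℤ := {x | F^[q + 1] x = x + P * n} with hO
  have haO : a ∈ O := hP
  have O_F : ∀ x ∈ O, F x ∈ O := by
    intro x hx
    change F^[q + 1] (F x) = _
    rw [← Function.iterate_succ_apply, Function.iterate_succ_apply', show F^[q + 1] x = _ from hx,
      h.shift_mul]
  have O_shift : ∀ x ∈ O, ∀ m : ℤ, x + m * n ∈ O := by
    intro x hx m
    change F^[q + 1] (x + m * n) = _
    rw [h.iterate_shift, show F^[q + 1] x = _ from hx]
    ring
  have O_surj : ∀ y ∈ O, ∃ x ∈ O, F x = y := by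
    intro y hy
    refine ⟨F^[q] y + (-P) * n, O_shift _ ?_ _, ?_⟩
    · have : ∀ r, F^[r] y ∈ O := by
        intro r
        induction r with
        | zero => exact hy
        | succ r ih =>
          rw [Function.iterate_succ_apply']
          exact O_F _ ih
      exact this q
    · rw [h.shift_mul, ← Function.iterate_succ_apply' F, show F^[q + 1] y = _ from hy]
      ring
  have O_strict : ∀ x ∈ O, ∀ y ∈ O, x < y → F x < F y := by
    intro x hx y hy hxy
    refine (h.mono hxy.le).lt_of_ne fun he => ?_
    have : F^[q + 1] x = F^[q + 1] y := by
      rw [Function.iterate_succ_apply, he, ← Function.iterate_succ_apply]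
    rw [show F^[q + 1] x = _ from hx, show F^[q + 1] y = _ from hy] at this
    omega
  have O_lift : ∀ x, p x ∈ p '' O → x ∈ O := by
    rintro x ⟨y, hy, hyx⟩
    obtain ⟨m, rfl⟩ := (h.eq_iff _ _).1 hyx.symm
    exact O_shift y hy m
  obtain ⟨K, c, hKS, hK, hcK, hc⟩ := hperf.exists_coloring (p '' O)
  set W : ℤ → ℤ → Finset ℤ := fun x y => (Finset.Ico x y).filter (· ∈ O) with hW
  have W_mem : ∀ x y z, z ∈ W x y ↔ (x ≤ z ∧ z < y) ∧ z ∈ O := by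
    intro x y z
    simp [hW]
  have W_F : ∀ x ∈ O, ∀ y ∈ O, (W (F x) (F y)).card = (W x y).card := by
    intro x hx y hy
    symm
    refine Finset.card_bij (fun z _ => F z) ?_ ?_ ?_
    · intro z hz
      rw [W_mem] at hz ⊢
      exact ⟨⟨h.mono hz.1.1, O_strict z hz.2 y hy hz.1.2⟩, O_F z hz.2⟩
    · intro z hz z' hz' he
      rw [W_mem] at hz hz'
      rcases lt_trichotomy z z' with hlt | heq | hlt
      · exact absurd he (O_strict z hz.2 z' hz'.2 hlt).ne
      · exact heq
      · exact absurd he (O_strict z' hz'.2 z hz.2 hlt).ne'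
    · intro z hz
      rw [W_mem] at hz
      obtain ⟨u, hu, rfl⟩ := O_surj z hz.2
      refine ⟨u, (W_mem _ _ _).2 ⟨⟨?_, ?_⟩, hu⟩, rfl⟩
      · by_contra! hlt
        exact absurd (O_strict u hu x hx hlt) (not_lt.2 hz.1.1)
      · by_contra! hle
        exact absurd (h.mono hle) (not_le.2 hz.1.2)
  have W_add : ∀ x y z, x ≤ y → y ≤ z → (W x z).card = (W x y).card + (W y z).card := by
    intro x y z hxy hyz
    rw [← Finset.card_union_of_disjoint]
    · congr 1
      ext u
      simp only [Finset.mem_union, W_mem]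
      constructor
      · rintro ⟨⟨h1, h2⟩, h3⟩
        rcases lt_or_ge u y with h4 | h4
        · exact Or.inl ⟨⟨h1, h4⟩, h3⟩
        · exact Or.inr ⟨⟨h4, h2⟩, h3⟩
      · rintro (⟨⟨h1, h2⟩, h3⟩ | ⟨⟨h1, h2⟩, h3⟩)
        · exact ⟨⟨h1, by omega⟩, h3⟩
        · exact ⟨⟨by omega, h2⟩, h3⟩
    · rw [Finset.disjoint_left]
      intro u h1 h2
      rw [W_mem] at h1 h2
      omega
  have W_const : ∀ x ∈ O, ∀ y ∈ O, x ≤ y → (W x (F x)).card = (W y (F y)).card := by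
    intro x hx y hy hxy
    have h1 := W_add x y (F y) hxy (h.lt_reach y).le
    have h2 := W_add x (F x) (F y) (h.lt_reach x).le (h.mono hxy)
    have h3 := W_F x hx y hy
    omega
  have W_const' : ∀ x ∈ O, ∀ y ∈ O, (W x (F x)).card = (W y (F y)).card := by
    intro x hx y hy
    rcases le_total x y with hxy | hxy
    · exact W_const x hx y hy hxy
    · exact (W_const y hy x hx hxy).symm
  have O_adj : ∀ x ∈ O, ∀ y ∈ O, x < y → y < F x → c (p x) ≠ c (p y) := fun x hx y hy hxy hyx =>
    hc _ ⟨x, hx, rfl⟩ _ ⟨y, hy, rfl⟩ (h.adj_of_lt hxy hyx)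
  -- A clique through `p x` injects into the window of `x`: vertices behind `x` are moved by `F`.
  have hKle : ∀ x ∈ O, p x ∈ K → K.card ≤ (W x (F x)).card := by
    intro x hx hxK
    choose l hl1 hl2 hl3 using h.exists_lift x
    have hlO : ∀ z ∈ K, l z ∈ O := fun z hz => O_lift _ (by rw [hl3]; exact hKS hz)
    have hback : ∀ z ∈ K, ¬ l z < F x → x + n < F (l z) := by
      intro z hz hlt
      have hxl : x < l z := lt_of_lt_of_le (h.lt_reach x) (not_lt.1 hlt)
      have hadj : G.Adj (p x) (p (l z)) := by
        refine hK hxK ?_ (h.ne_of_lt hxl (hl2 z))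
        rw [hl3]
        exact hz
      exact ((h.adj_iff _ _ hxl (hl2 z)).1 hadj).resolve_left hlt
    have mixed : ∀ z ∈ K, ∀ z' ∈ K, l z < F x → ¬ l z' < F x → l z ≠ F (l z') - n := by
      intro z hz z' hz' h1 h2 he
      have h3 := hl1 z
      have h4 := hl2 z'
      have hlt : l z < l z' := by omega
      have hadj : G.Adj (p (l z)) (p (l z')) := by
        refine hK ?_ ?_ (h.ne_of_lt hlt (by omega)) <;> rw [hl3] <;> assumption
      rcases (h.adj_iff _ _ hlt (by omega)).1 hadj with h5 | h5
      · rw [he, show F (l z') - n = F (l z') + (-1) * n by ring, h.shift_mul] at h5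
        have := h.reach_reach_lt (l z')
        omega
      · omega
    refine Finset.card_le_card_of_injOn (fun z => if l z < F x then l z else F (l z) - n) ?_ ?_
    · intro z hz
      rw [Finset.mem_coe, W_mem]
      by_cases hlt : l z < F x
      · simp only [hlt, if_true]
        exact ⟨⟨hl1 z, trivial⟩, hlO z hz⟩
      · simp only [hlt, if_false]
        have h1 := hback z hz hlt
        have h2 := O_strict _ (hlO z hz) _ (O_shift x hx 1) (by linarith [hl2 z])
        rw [h.shift_mul] at h2
        refine ⟨⟨by omega, by omega⟩, ?_⟩
        have := O_shift _ (O_F _ (hlO z hz)) (-1)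
        rwa [neg_one_mul, ← sub_eq_add_neg] at this
    · intro z hz z' hz' he
      by_cases h1 : l z < F x <;> by_cases h2 : l z' < F x <;>
        simp only [h1, h2, if_true, if_false] at he
      · rw [← hl3 z, ← hl3 z', he]
      · exact absurd he (mixed z hz z' hz' h1 h2)
      · exact absurd he.symm (mixed z' hz' z hz h2 h1)
      · have he : F (l z) = F (l z') := by omega
        rcases lt_trichotomy (l z) (l z') with hlt | heq | hlt
        · exact absurd he (O_strict _ (hlO z hz) _ (hlO z' hz') hlt).ne
        · rw [← hl3 z, ← hl3 z', heq]
        · exact absurd he (O_strict _ (hlO z' hz') _ (hlO z hz) hlt).ne'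
  have hKle' : ∀ x ∈ O, K.card ≤ (W x (F x)).card := by
    intro x hx
    rcases K.eq_empty_or_nonempty with rfl | ⟨z, hz⟩
    · simp
    · obtain ⟨y, hy, rfl⟩ := hKS hz
      rw [W_const' x hx y hy]
      exact hKle y hy hz
  -- The window of `x` uses every colour, and only `x` itself is not adjacent to `F x`.
  have hcF : ∀ x ∈ O, c (p (F x)) = c (p x) := by
    intro x hx
    have hsurj := Finset.surj_on_of_inj_on_of_card_le (s := W x (F x)) (t := Finset.range K.card)
      (fun z _ => c (p z)) (fun z hz => Finset.mem_range.2 (hcK _ ⟨z, ((W_mem _ _ _).1 hz).2, rfl⟩))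
      (by
        intro z z' hz hz' he
        rw [W_mem] at hz hz'
        rcases lt_trichotomy z z' with hlt | heq | hlt
        · exact absurd he (O_adj z hz.2 z' hz'.2 hlt (hz'.1.2.trans_le (h.mono hz.1.1)))
        · exact heq
        · exact absurd he.symm (O_adj z' hz'.2 z hz.2 hlt (hz.1.2.trans_le (h.mono hz'.1.1))))
      (by rw [Finset.card_range]; exact hKle' x hx)
      (c (p (F x))) (Finset.mem_range.2 (hcK _ ⟨F x, O_F x hx, rfl⟩))
    obtain ⟨z, hz, hzc⟩ := hsurj
    rw [W_mem] at hz
    rcases hz.1.1.eq_or_lt with rfl | hlt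
    · exact hzc
    · exact absurd hzc.symm (O_adj z hz.2 (F x) (O_F x hx) hz.1.2 (O_strict x hx z hz.2 hlt))
  have hiter : ∀ t : ℕ, F^[t] a ∈ O ∧ c (p (F^[t] a)) = c (p a) := by
    intro t
    induction t with
    | zero => exact ⟨haO, rfl⟩
    | succ t ih =>
      rw [Function.iterate_succ_apply']
      exact ⟨O_F _ ih.1, (hcF _ ih.1).trans ih.2⟩
  have hex : ∃ t : ℕ, a + n ≤ F^[t] a := ⟨n, h.le_iterate a n⟩
  obtain ⟨k, hk, hkmin⟩ : ∃ k, a + n ≤ F^[k] a ∧ ∀ j < k, ¬ a + n ≤ F^[j] a :=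
    ⟨Nat.find hex, Nat.find_spec hex, fun j hj => Nat.find_min hex hj⟩
  have h3k : 3 ≤ k := by
    by_contra! hlt
    have h1 := h.reach_lt a
    have h2 := h.reach_reach_lt a
    interval_cases k
    · simp only [Function.iterate_zero, id] at hk
      omega
    · simp only [Function.iterate_one] at hk
      omega
    · simp only [Function.iterate_succ, Function.iterate_zero, Function.comp, id] at hk
      omega
  refine ⟨a, k, h3k, le_antisymm ?_ hk⟩
  obtain ⟨j, rfl⟩ : ∃ j, k = j + 1 := ⟨k - 1, by omega⟩
  have h1 := hkmin j (Nat.lt_succ_self j)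
  by_contra! hlt
  rw [Function.iterate_succ_apply'] at hlt
  have h2 := O_adj _ (hiter j).1 _ (O_shift a haO 1) (by linarith) (by linarith)
  rw [h.vertex_shift] at h2
  exact h2 (hiter j).2

end IsReach

/-- The final group of the block `[b, F b)`: the positions `u` in its interior that are adjacent to
the first position `F b` of the next block. -/
def tailGroup (F : ℤ → ℤ) (b : ℤ) : Set ℤ := {u | b < u ∧ u < F b ∧ F b < F u}

namespace IsReach

variable {V : Type*} {G : SimpleGraph V} {n : ℕ} {p : ℤ → V} {F : ℤ → ℤ}

/-! ### Parity of the number of direct transitions between blocks -/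

theorem sub_one_mem_tailGroup (h : G.IsReach n p F) (b : ℤ) : F b - 1 ∈ tailGroup F b := by
  have h1 := h.three_le b
  have h2 := h.three_le (F b - 1)
  refine ⟨?_, ?_, ?_⟩ <;> omega

theorem sub_two_mem_tailGroup (h : G.IsReach n p F) (b : ℤ) : F b - 2 ∈ tailGroup F b := by
  have h1 := h.three_le b
  have h2 := h.three_le (F b - 2)
  refine ⟨?_, ?_, ?_⟩ <;> omega

theorem add_mul_mem_tailGroup (h : G.IsReach n p F) {b u : ℤ} (hu : u ∈ tailGroup F b) (m : ℤ) :
    u + m * n ∈ tailGroup F (b + m * n) := by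
  obtain ⟨h1, h2, h3⟩ := hu
  refine ⟨by omega, ?_, ?_⟩ <;> simp only [h.shift_mul] <;> omega

theorem iterate_period_add (h : G.IsReach n p F) {a : ℤ} {k : ℕ} (ha : F^[k] a = a + n) (t : ℕ) :
    F^[t + k] a = F^[t] a + n := by
  rw [Function.iterate_add_apply, ha]
  have := h.iterate_shift t a 1
  rwa [one_mul] at this

theorem iterate_period_mul (h : G.IsReach n p F) {a : ℤ} {k : ℕ} (ha : F^[k] a = a + n)
    (t m : ℕ) : F^[t + k * m] a = F^[t] a + m * n := by
  induction m with
  | zero => simp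
  | succ m ih =>
    rw [Nat.mul_succ, ← Nat.add_assoc, h.iterate_period_add ha, ih]
    push_cast
    ring

theorem iterate_strictMono (h : G.IsReach n p F) (a : ℤ) : StrictMono fun t : ℕ => F^[t] a :=
  strictMono_nat_of_lt_succ fun t => by
    rw [Function.iterate_succ_apply']
    exact h.lt_reach _

/-- A closed transversal of the blocks: `W t` lies in the final group of the block at `Fᵗ a`.
Joining consecutive members directly where they are adjacent, and through the first position of the
next block elsewhere, gives an induced cycle of length `2 k - d`, where `d` counts the direct
transitions.  Perfection makes `d` even, unless the cycle is a triangle. -/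
theorem sum_direct_eq_zero_of_periodic [Finite V] (h : G.IsReach n p F) (hperf : G.IsPerfect)
    {a : ℤ} {k : ℕ} (hk : 3 ≤ k) (ha : F^[k] a = a + n) (W : ℕ → ℤ)
    (hW : ∀ t, W t ∈ tailGroup F (F^[t] a)) (hWk : ∀ t, W (t + k) = W t + n)
    (htri : ¬ (k = 3 ∧ ∀ t, W (t + 1) < F (W t))) :
    ∑ t ∈ Finset.range k, (if W (t + 1) < F (W t) then (1 : ZMod 2) else 0) = 0 := by
  classical
  have hn := h.n_pos
  set A : ℕ → ℤ := fun t => F^[t] a with hA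
  have A_succ : ∀ t, F (A t) = A (t + 1) := fun t => (Function.iterate_succ_apply' F t a).symm
  have A_lt : ∀ {s t}, A s < A t ↔ s < t := (h.iterate_strictMono a).lt_iff_lt
  have A_le : ∀ {s t}, A s ≤ A t ↔ s ≤ t := (h.iterate_strictMono a).le_iff_le
  have A_k : ∀ t, A (t + k) = A t + n := h.iterate_period_add ha
  have W1 : ∀ t, A t < W t := fun t => (hW t).1
  have W2 : ∀ t, W t < A (t + 1) := fun t => by have := (hW t).2.1; rwa [A_succ] at this
  have W3 : ∀ t, A (t + 1) < F (W t) := fun t => by have := (hW t).2.2; rwa [A_succ] at this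
  have W4 : ∀ t, F (W t) ≤ A (t + 2) := fun t => (h.mono (W2 t).le).trans_eq (A_succ _)
  have W_lt : ∀ s t, W s < A (t + 1) → s ≤ t := fun s t hst =>
    Nat.lt_succ_iff.1 (A_lt.1 ((W1 s).trans hst))
  have W_gt : ∀ s t, A t < W s → t ≤ s := fun s t hst =>
    Nat.lt_succ_iff.1 (A_lt.1 (hst.trans (W2 s)))
  have WW : ∀ s t, W s < W t → s < t := by
    intro s t hst
    by_contra! hle
    rcases hle.eq_or_lt with rfl | hlt
    · exact lt_irrefl _ hst
    · have := (W2 t).trans_le ((A_le.2 hlt).trans (W1 s).le)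
      omega
  set S : Set ℤ := {x | ∃ t, x = W t ∨ (x = A (t + 1) ∧ F (W t) ≤ W (t + 1))} with hS
  have S_add : ∀ x ∈ S, ∀ m : ℕ, x + m * n ∈ S := by
    intro x hx m
    induction m with
    | zero => simpa using hx
    | succ m ih =>
      obtain ⟨t, ht | ⟨ht, ht'⟩⟩ := ih
      · refine ⟨t + k, Or.inl ?_⟩
        rw [hWk, ← ht]
        push_cast
        ring
      · refine ⟨t + k, Or.inr ⟨?_, ?_⟩⟩
        · rw [show t + k + 1 = t + 1 + k by omega, A_k, ← ht]
          push_cast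
          ring
        · rw [show t + k + 1 = t + 1 + k by omega, hWk, hWk, h.shift]
          omega
  have S_sub : ∀ x ∈ S, A 0 < x - n → x - n ∈ S := by
    rintro x ⟨t, ht | ⟨ht, ht'⟩⟩ hx
    · obtain ⟨r, rfl⟩ : ∃ r, t = r + k := by
        refine ⟨t - k, ?_⟩
        have := W_gt t (0 + k) (by rw [A_k]; omega)
        omega
      exact ⟨r, Or.inl (by rw [ht, hWk]; ring)⟩
    · obtain ⟨r, rfl⟩ : ∃ r, t = r + k := by
        refine ⟨t - k, ?_⟩
        have : 0 + k < t + 1 := A_lt.1 (by rw [A_k]; omega)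
        omega
      refine ⟨r, Or.inr ⟨?_, ?_⟩⟩
      · rw [ht, show r + k + 1 = r + 1 + k by omega, A_k]
        ring
      · rw [show r + k + 1 = r + 1 + k by omega, hWk, hWk, h.shift] at ht'
        omega
  have S_lift : ∀ b, A 0 < b → ∀ x ∈ p '' S, ∃ s ∈ S, b ≤ s ∧ s < b + n ∧ p s = x := by
    rintro b hb _ ⟨y, hy, rfl⟩
    obtain ⟨i, hi1, hi2, hi3⟩ := h.exists_lift b (p y)
    obtain ⟨m, hm⟩ := (h.eq_iff _ _).1 hi3
    refine ⟨i, ?_, hi1, hi2, hi3⟩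
    rcases le_or_gt 0 m with h0 | h0
    · obtain ⟨r, rfl⟩ := Int.eq_ofNat_of_zero_le h0
      rw [hm]
      exact S_add y hy r
    · have hsub : ∀ r : ℕ, A 0 < y - r * n → y - r * n ∈ S := by
        intro r
        induction r with
        | zero => intro _; simpa using hy
        | succ r ih =>
          intro hr
          push_cast at hr ⊢
          have e : y - (r + 1) * n = y - r * n - n := by ring
          rw [e] at hr ⊢
          exact S_sub _ (ih (by omega)) hr
      obtain ⟨r, hr⟩ := Int.eq_ofNat_of_zero_le (show 0 ≤ -m by omega)
      have e : i = y - r * n := by rw [hm, ← hr]; ring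
      rw [e]
      exact hsub r (by rw [← e]; omega)
  -- Every reach contains at most one later element of `S`.
  have S_succ : ∀ s ∈ S, ∀ t ∈ S, ∀ u ∈ S, s < t → t < u → F s ≤ u := by
    rintro s ⟨i, hs⟩ t ⟨j, ht⟩ u ⟨l, hu⟩ hst htu
    by_contra! hlt
    rcases hs with rfl | ⟨rfl, -⟩
    · have hu2 : u < A (i + 2) := hlt.trans_le (W4 i)
      rcases hu with rfl | ⟨rfl, -⟩
      · have hl := W_lt l (i + 1) hu2
        rcases ht with rfl | ⟨rfl, hD⟩
        · have h1 := WW _ _ hst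
          have h2 := WW _ _ htu
          omega
        · have h1 : i < j + 1 := A_lt.1 ((W1 i).trans hst)
          have h2 := W_gt _ _ htu
          obtain rfl : j = i := by omega
          obtain rfl : l = j + 1 := by omega
          omega
      · have hl : l + 1 < i + 2 := A_lt.1 hu2
        rcases ht with rfl | ⟨rfl, hD⟩
        · have h1 := WW _ _ hst
          have h2 := W_lt _ _ htu
          omega
        · have h1 : i < j + 1 := A_lt.1 ((W1 i).trans hst)
          have h2 : j + 1 < l + 1 := A_lt.1 htu
          omega
    · rw [A_succ] at hlt
      rcases hu with rfl | ⟨rfl, -⟩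
      · have hl := W_lt l (i + 1) hlt
        rcases ht with rfl | ⟨rfl, hD⟩
        · have h1 := W_gt _ _ hst
          have h2 := WW _ _ htu
          omega
        · have h1 : i + 1 < j + 1 := A_lt.1 hst
          have h2 := W_gt _ _ htu
          omega
      · have h1 : i + 1 < l + 1 := A_lt.1 (hst.trans htu)
        have h2 : l + 1 < i + 1 + 1 := A_lt.1 hlt
        omega
  -- Hence a triangle in `S` goes once around the circle; this needs `k = 3` and direct transitions.
  have S_tri : ∀ s ∈ S, ∀ t ∈ S, ∀ u ∈ S, s < t → t < u → u < s + n → G.Adj (p s) (p t) →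
      G.Adj (p s) (p u) → ¬ G.Adj (p t) (p u) := by
    intro s hs t ht u hu hst htu hus ast asu atu
    have hs' : s + n ∈ S := by simpa using S_add s hs 1
    have ht' : t + n ∈ S := by simpa using S_add t ht 1
    have h1 := S_succ s hs t ht u hu hst htu
    have h2 := S_succ t ht u hu _ hs' htu hus
    have h3 := S_succ u hu _ hs' _ ht' hus (by omega)
    have d1 : s + n < F u := by
      rcases (h.adj_iff _ _ (hst.trans htu) hus).1 asu with h' | h' <;> omega
    have d2 : t < F s := by
      rcases (h.adj_iff _ _ hst (by omega)).1 ast with h' | h' <;> omega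
    have d3 : u < F t := by
      rcases (h.adj_iff _ _ htu (by omega)).1 atu with h' | h' <;> omega
    have three : ∀ {x y z : ℤ}, y < F x → z < F y → x + n < F z → x + n < F (F (F x)) :=
      fun {x y z} e1 e2 e3 =>
        e3.trans_le (h.mono (e2.le.trans (h.mono e1.le)))
    have ts := three d2 d3 d1
    have tt := three d3 d1 (show t + n < F (s + n) by rw [h.shift]; omega)
    have tu := three d1 (show t + n < F (s + n) by rw [h.shift]; omega)
      (show u + n < F (t + n) by rw [h.shift]; omega)
    have hk3 : k = 3 := by
      by_contra hne
      have : ∃ i, A i ≤ s ∧ s ≤ A (i + 1) := by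
        obtain ⟨i, rfl | ⟨rfl, -⟩⟩ := hs
        · exact ⟨i, (W1 i).le, (W2 i).le⟩
        · exact ⟨i, A_le.2 (by omega), le_rfl⟩
      obtain ⟨i, h4, h5⟩ := this
      have h6 := h.mono (h.mono (h.mono h5))
      rw [A_succ, A_succ, A_succ] at h6
      have h7 : A (i + 1 + 1 + 1 + 1) ≤ A (i + k) := A_le.2 (by omega)
      rw [A_k] at h7
      omega
    subst hk3
    have notA : ∀ x i, x + n < F (F (F x)) → x ≠ A (i + 1) := by
      rintro x i hx rfl
      rw [A_succ, A_succ, A_succ, show i + 1 + 1 + 1 + 1 = i + 1 + 3 by omega, A_k] at hx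
      omega
    obtain ⟨i, rfl | ⟨e, -⟩⟩ := hs
    swap
    · exact notA _ _ ts e
    obtain ⟨j, rfl | ⟨e, -⟩⟩ := ht
    swap
    · exact notA _ _ tt e
    obtain ⟨l, rfl | ⟨e, -⟩⟩ := hu
    swap
    · exact notA _ _ tu e
    rw [← hWk] at hus d1
    have hij := WW _ _ hst
    have hjl := WW _ _ htu
    have hli := WW _ _ hus
    obtain rfl : j = i + 1 := by omega
    obtain rfl : l = i + 2 := by omega
    refine htri ⟨rfl, ?_⟩
    have hperD : Function.Periodic (fun t => W (t + 1) < F (W t)) 3 := by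
      intro t
      simp only
      rw [show t + 3 + 1 = t + 1 + 3 by omega, hWk, hWk, h.shift, add_lt_add_iff_right]
    have hD : ∀ r, (W (r % 3 + 1) < F (W (r % 3))) ↔ W (r + 1) < F (W r) := fun r =>
      iff_of_eq (hperD.map_mod_nat r)
    have e0 := (hD i).2 d2
    have e1 := (hD (i + 1)).2 d3
    have e2 := (hD (i + 2)).2 d1
    intro r
    rw [← hD]
    have hcases : r % 3 = i % 3 ∨ r % 3 = (i + 1) % 3 ∨ r % 3 = (i + 2) % 3 := by omega
    rcases hcases with e | e | e <;> rw [e] <;> assumption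
  -- So two colours suffice for `S`, and they alternate along the cycle.
  obtain ⟨K, c, hKS, hK, hcK, hc⟩ := hperf.exists_coloring (p '' S)
  have hK2 : K.card ≤ 2 := by
    by_contra! hlt
    obtain ⟨x, hx, y, hy, z, hz, hxy, hxz, hyz⟩ := Finset.two_lt_card.1 hlt
    obtain ⟨s, hs, hs1, -, rfl⟩ := S_lift (A 0 + 1) (by omega) x (hKS hx)
    obtain ⟨t, ht, ht1, ht2, rfl⟩ := S_lift s (by omega) y (hKS hy)
    obtain ⟨u, hu, hu1, hu2, rfl⟩ := S_lift s (by omega) z (hKS hz)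
    have hst : s < t := ht1.lt_of_ne (by rintro rfl; exact hxy rfl)
    have hsu : s < u := hu1.lt_of_ne (by rintro rfl; exact hxz rfl)
    have htu : t ≠ u := by rintro rfl; exact hyz rfl
    rcases lt_or_gt_of_ne htu with h1 | h1
    · exact S_tri s hs t ht u hu hst h1 hu2 (hK hx hy hxy) (hK hx hz hxz) (hK hy hz hyz)
    · exact S_tri s hs u hu t ht hsu h1 ht2 (hK hx hz hxz) (hK hx hy hxy) (hK hz hy hyz.symm)
  have flip : ∀ x ∈ S, ∀ y ∈ S, x < y → y < F x →
      (c (p y) : ZMod 2) = (c (p x) : ZMod 2) + 1 := by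
    intro x hx y hy hxy hyx
    have h1 := hcK _ ⟨x, hx, rfl⟩
    have h2 := hcK _ ⟨y, hy, rfl⟩
    have h3 := hc _ ⟨x, hx, rfl⟩ _ ⟨y, hy, rfl⟩ (h.adj_of_lt hxy hyx)
    have h4 : c (p x) = 0 ∧ c (p y) = 1 ∨ c (p x) = 1 ∧ c (p y) = 0 := by omega
    rcases h4 with ⟨e1, e2⟩ | ⟨e1, e2⟩ <;> rw [e1, e2] <;> decide
  have step : ∀ t, (c (p (W (t + 1))) : ZMod 2) =
      c (p (W t)) + if W (t + 1) < F (W t) then (1 : ZMod 2) else 0 := by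
    intro t
    have hWS : ∀ t, W t ∈ S := fun t => ⟨t, Or.inl rfl⟩
    split_ifs with hD
    · exact flip _ (hWS t) _ (hWS _) ((W2 t).trans (W1 _)) hD
    · have hAS : A (t + 1) ∈ S := ⟨t, Or.inr ⟨rfl, not_lt.1 hD⟩⟩
      rw [flip _ hAS _ (hWS _) (W1 _) (by rw [A_succ]; exact W2 _),
        flip _ (hWS t) _ hAS (W2 t) (W3 t), add_assoc]
      rfl
  have tele : ∀ r, (c (p (W r)) : ZMod 2) = c (p (W 0)) +
      ∑ t ∈ Finset.range r, (if W (t + 1) < F (W t) then (1 : ZMod 2) else 0) := by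
    intro r
    induction r with
    | zero => simp
    | succ r ih => rw [Finset.sum_range_succ, step, ih, add_assoc]
  have hend := tele k
  have hW0 : p (W k) = p (W 0) := by
    have := hWk 0
    rw [zero_add] at this
    rw [this]
    simpa using h.vertex_shift (W 0) 1
  rw [hW0] at hend
  exact (left_eq_add.1 hend)

/-- The parity statement for a transversal given on one turn only. -/
theorem sum_direct_eq_zero [Finite V] (h : G.IsReach n p F) (hperf : G.IsPerfect)
    {a : ℤ} {k : ℕ} (hk : 3 ≤ k) (ha : F^[k] a = a + n) (g : ℕ → ℤ)
    (hg : ∀ t < k, g t ∈ tailGroup F (F^[t] a)) (hgk : g k = g 0 + n)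
    (htri : ¬ (k = 3 ∧ g 1 < F (g 0) ∧ g 2 < F (g 1) ∧ g 3 < F (g 2))) :
    ∑ t ∈ Finset.range k, (if g (t + 1) < F (g t) then (1 : ZMod 2) else 0) = 0 := by
  set W : ℕ → ℤ := fun t => g (t % k) + (t / k : ℕ) * n with hWdef
  have hWg : ∀ t ≤ k, W t = g t := by
    intro t ht
    rcases ht.eq_or_lt with rfl | hlt
    · simp only [hWdef]
      rw [Nat.mod_self, Nat.div_self (by omega), hgk]
      simp
    · simp only [hWdef]
      rw [Nat.mod_eq_of_lt hlt, Nat.div_eq_of_lt hlt]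
      simp
  have key := h.sum_direct_eq_zero_of_periodic hperf hk ha W ?_ ?_ ?_
  · refine Eq.trans ?_ key
    refine Finset.sum_congr rfl fun t ht => ?_
    rw [Finset.mem_range] at ht
    rw [hWg t ht.le, hWg (t + 1) ht]
  · intro t
    have h1 := h.add_mul_mem_tailGroup (hg (t % k) (Nat.mod_lt _ (by omega))) (t / k : ℕ)
    have h2 := h.iterate_period_mul ha (t % k) (t / k)
    rw [Nat.mod_add_div] at h2
    rw [h2]
    exact h1
  · intro t
    simp only [hWdef]
    rw [Nat.add_mod_right, Nat.add_div_right _ (by omega)]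
    push_cast
    ring
  · rintro ⟨rfl, hall⟩
    refine htri ⟨rfl, ?_, ?_, ?_⟩
    · have := hall 0
      rwa [hWg _ (by omega), hWg _ (by omega)] at this
    · have := hall 1
      rwa [hWg _ (by omega), hWg _ (by omega)] at this
    · have := hall 2
      rwa [hWg _ (by omega), hWg _ (by omega)] at this

/-! ### No position has neighbours in both adjacent blocks -/

/-- In a reduced graph consecutive positions are distinguished by their forward or by their
backward reach. -/
theorem exists_reach_eq (h : G.IsReach n p F) (hred : G.IsReduced) {x : ℤ}
    (hx : F (x - 1) = F x) : ∃ u, F u = x := by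
  by_contra! hcon
  have h1 := h.three_le (x - 1)
  have h2 := h.reach_lt (x - 1)
  have hadj : G.Adj (p (x - 1)) (p x) := h.adj_of_lt (by omega) (by omega)
  refine hadj.ne (hred _ _ (Set.ext fun y => ?_))
  rw [mem_closedNbhd, mem_closedNbhd]
  obtain ⟨m, hm1, hm2, rfl⟩ := h.exists_lift (x - 1) y
  rcases hm1.eq_or_lt with rfl | hm1
  · exact iff_of_true (Or.inl rfl) (Or.inr hadj.symm)
  rcases (show x ≤ m by omega).eq_or_lt with rfl | hm3
  · exact iff_of_true (Or.inr hadj) (Or.inl rfl)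
  have e1 := h.ne_of_lt hm1 hm2
  have e2 := h.ne_of_lt hm3 (by omega)
  have e3 : F m ≠ x + n := by
    intro e
    refine hcon (m + (-1) * n) ?_
    rw [h.shift_mul, e]
    ring
  rw [h.adj_iff _ _ hm1 hm2, h.adj_iff _ _ hm3 (by omega), hx]
  simp only [e1.symm, e2.symm, false_or]
  constructor <;> rintro (h' | h')
  · exact Or.inl h'
  · exact Or.inr (by omega)
  · exact Or.inl h'
  · exact Or.inr (by omega)

/-- A position whose reach is the last position of the block `[F b, F (F b))` lies in the final
group of the block `[b, F b)`. -/
theorem mem_tailGroup_of_reach_eq (h : G.IsReach n p F) {b u : ℤ} (hu : F u = F (F b) - 1) :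
    u ∈ tailGroup F b := by
  have h1 := h.three_le (F b)
  refine ⟨?_, ?_, by omega⟩
  · by_contra! hle
    have := h.mono hle
    omega
  · by_contra! hle
    have := h.mono hle
    omega

theorem exists_prev (h : G.IsReach n p F) {a : ℤ} {k : ℕ} (hk : 3 ≤ k) (ha : F^[k] a = a + n) :
    ∃ b, F b = a ∧ F^[k] b = b + n := by
  obtain ⟨k, rfl⟩ : ∃ j, k = j + 1 := ⟨k - 1, by omega⟩
  refine ⟨F^[k] a + (-1) * n, ?_, ?_⟩
  · rw [h.shift_mul, ← Function.iterate_succ_apply' F, ha]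
    ring
  · rw [h.iterate_shift, ← Function.iterate_add_apply, Nat.add_comm, Function.iterate_add_apply, ha]
    have := h.iterate_shift k a 1
    rw [one_mul] at this
    rw [this]
    ring

theorem iterate_reach (h : G.IsReach n p F) {a : ℤ} {k : ℕ} (ha : F^[k] a = a + n) :
    F^[k] (F a) = F a + n := by
  rw [← Function.iterate_succ_apply, Function.iterate_succ_apply', ha, h.shift]

/-- Moving one member of a transversal, all other members being fixed, does not change the parity
of the number of direct transitions on its two sides. -/
theorem direct_add_direct_eq [Finite V] (h : G.IsReach n p F) (hperf : G.IsPerfect) {a : ℤ} {k : ℕ}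
    (hk : 3 ≤ k) (ha : F^[k] a = a + n)
    (htri : k = 3 → ∀ u ∈ tailGroup F a, ∀ w ∈ tailGroup F (F a), ∀ z ∈ tailGroup F (F (F a)),
      w < F u → z < F w → F z ≤ u + n)
    {u x y z : ℤ} (hu : u ∈ tailGroup F a) (hx : x ∈ tailGroup F (F a))
    (hy : y ∈ tailGroup F (F a)) (hz : z ∈ tailGroup F (F (F a))) :
    ((if x < F u then 1 else 0) + (if z < F x then 1 else 0) : ZMod 2) =
      (if y < F u then 1 else 0) + (if z < F y then 1 else 0) := by
  obtain ⟨j, rfl⟩ : ∃ j, k = j + 3 := ⟨k - 3, by omega⟩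
  set g : ℤ → ℕ → ℤ := fun w t => if t = 0 then u else if t = 1 then w else if t = 2 then z else
    if t = j + 3 then u + n else F^[t + 1] a - 1 with hg
  have key : ∀ w ∈ tailGroup F (F a), ∑ t ∈ Finset.range (j + 3),
      (if g w (t + 1) < F (g w t) then (1 : ZMod 2) else 0) = 0 := by
    intro w hw
    refine h.sum_direct_eq_zero hperf hk ha (g w) ?_ (by simp [hg]) ?_
    · intro t ht
      simp only [hg]
      split_ifs with h0 h1 h2 h3
      · rw [h0]; exact hu
      · rw [h1]; exact hw
      · rw [h2]; exact hz
      · omega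
      · rw [Function.iterate_succ_apply']
        exact h.sub_one_mem_tailGroup _
    · rintro ⟨hj, h1, h2, h3⟩
      obtain rfl : j = 0 := by omega
      simp only [hg] at h1 h2 h3
      norm_num at h1 h2 h3
      have := htri hj u hu w hw z hz h1 h2
      omega
  -- Only the first two terms of the sum depend on `w`.
  have split : ∀ w, ∑ t ∈ Finset.range (j + 3),
      (if g w (t + 1) < F (g w t) then (1 : ZMod 2) else 0) =
      (∑ t ∈ Finset.range (j + 1),
        (if g 0 (t + 1 + 1 + 1) < F (g 0 (t + 1 + 1)) then (1 : ZMod 2) else 0)) +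
      ((if w < F u then 1 else 0) + (if z < F w then 1 else 0)) := by
    intro w
    rw [Finset.sum_range_succ', Finset.sum_range_succ', add_assoc]
    congr 1
    rw [add_comm]
    rfl
  have e1 := key x hx
  have e2 := key y hy
  rw [split] at e1 e2
  exact add_left_cancel (e1.trans e2.symm)

/-- The case in which no transversal forms a triangle around the circle.  If the last member `X` of
a final group has a neighbour in the next final group, then some member of the latter is adjacent to
`X` but not to `X - 1`.  By parity every member of the previous final group then has reach `X`,
although its last two members would have to have different reaches. -/
theorem reach_le_of_no_triangle [Finite V] (h : G.IsReach n p F) (hred : G.IsReduced)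
    (hperf : G.IsPerfect) {k : ℕ} (hk : 3 ≤ k)
    (htri : k = 3 → ∀ a, F^[k] a = a + n → ∀ u ∈ tailGroup F a, ∀ w ∈ tailGroup F (F a),
      ∀ z ∈ tailGroup F (F (F a)), w < F u → z < F w → F z ≤ u + n)
    {a : ℤ} (ha : F^[k] a = a + n) {u w : ℤ} (hu : u ∈ tailGroup F a)
    (hw : w ∈ tailGroup F (F a)) : F u ≤ w := by
  -- If `F b - 1` and `F b - 2` had the same reach, some `v` would be adjacent to the second only,
  -- contrary to parity.
  have last_two : ∀ b, F^[k] b = b + n → ∀ w ∈ tailGroup F (F b), w < F (F b - 1) →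
      ∃ z ∈ tailGroup F (F b), F (F b - 2) ≤ z ∧ z < F (F b - 1) := by
    intro b hb w hw hwX
    have hYX := h.mono (show F b - 2 ≤ F b - 1 by omega)
    obtain ⟨c, rfl, hc⟩ := h.exists_prev hk hb
    rcases hYX.eq_or_lt with heq | hlt
    · obtain ⟨v, hv⟩ := h.exists_reach_eq hred
        (x := F (F c) - 1) (by rw [← heq]; congr 1; ring)
      have key := h.direct_add_direct_eq hperf hk hc (fun e => htri e c hc)
        (h.mem_tailGroup_of_reach_eq hv) (h.sub_one_mem_tailGroup (F c))
        (h.sub_two_mem_tailGroup (F c)) hw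
      rw [heq, hv] at key
      simp [hwX] at key
    · by_cases hYw : F (F (F c) - 2) ≤ w
      · exact ⟨w, hw, hYw, hwX⟩
      · refine ⟨F (F (F c) - 2), ⟨?_, ?_, ?_⟩, le_rfl, hlt⟩
        · exact (h.sub_two_mem_tailGroup (F c)).2.2
        · exact hlt.trans_le (h.mono (by omega))
        · exact hw.2.2.trans_le (h.mono (by omega))
  by_contra! hlt
  obtain ⟨hu1, hu2, hu3⟩ := hu
  have hwX : w < F (F a - 1) := hlt.trans_le (h.mono (by omega))
  obtain ⟨z, hz, hYz, hzX⟩ := last_two a ha w hw hwX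
  obtain ⟨c, rfl, hc⟩ := h.exists_prev hk ha
  have all : ∀ v ∈ tailGroup F c, F v = F (F c) - 1 := by
    intro v hv
    have key := h.direct_add_direct_eq hperf hk hc (fun e => htri e c hc) hv
      (h.sub_one_mem_tailGroup (F c)) (h.sub_two_mem_tailGroup (F c)) hz
    rw [if_pos hzX, if_neg (not_lt.2 hYz)] at key
    split_ifs at key with k1 k2 k2
    · exact absurd key (by decide)
    · omega
    · omega
    · exact absurd key (by decide)
  obtain ⟨z', -, h1, h2⟩ := last_two c hc _ (h.sub_two_mem_tailGroup (F c))
    (by rw [all _ (h.sub_one_mem_tailGroup c)]; omega)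
  rw [all _ (h.sub_one_mem_tailGroup c)] at h2
  rw [all _ (h.sub_two_mem_tailGroup c)] at h1
  omega

/-- The case of a triangle around three blocks.  As the adjacencies between consecutive final groups
avoid the patterns that span `F₂` or `F₃`, between each two of them they depend on the earlier
member only or on the later member only.  Reducedness makes the same alternative hold for all three
pairs, and then some transversal has exactly one direct transition. -/
theorem false_of_triangle [Finite V] (h : G.IsReach n p F) (hred : G.IsReduced)
    (hperf : G.IsPerfect)
    (hpat : ∀ b, F^[3] b = b + n → ∀ u ∈ tailGroup F b, ∀ u' ∈ tailGroup F b,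
      ∀ q ∈ tailGroup F (F b), ∀ r ∈ tailGroup F (F b), u < u' → q < r → q < F u' → F u ≤ r →
        ¬ (q < F u ↔ r < F u'))
    {a : ℤ} (ha : F^[3] a = a + n) {u w z : ℤ} (hu : u ∈ tailGroup F a)
    (hw : w ∈ tailGroup F (F a)) (hz : z ∈ tailGroup F (F (F a))) (huw : w < F u) (hwz : z < F w)
    (hzu : u + n < F z) : False := by
  -- Adjacency depends on the earlier member only, or on the later member only.
  have dichotomy : ∀ b, F^[3] b = b + n → ∀ u ∈ tailGroup F b, ∀ w ∈ tailGroup F (F b), w < F u →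
      (F (F b - 1) = F (F b) ∧ ∀ v ∈ tailGroup F b,
        F v = F (F b) ∨ ∀ w ∈ tailGroup F (F b), F v ≤ w) ∨
      (F (F b - 1) < F (F b) ∧ ∀ v ∈ tailGroup F b, F v = F (F b - 1)) := by
    intro b hb u hu w hw huw
    obtain ⟨m, hm, hmin⟩ : ∃ m ∈ tailGroup F (F b), ∀ w ∈ tailGroup F (F b), m ≤ w := by
      obtain ⟨m, hm, hmin⟩ := Int.exists_least_of_bdd (P := fun x => x ∈ tailGroup F (F b))
        ⟨F b, fun z hz => hz.1.le⟩ ⟨w, hw⟩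
      exact ⟨m, hm, hmin⟩
    have hX := h.sub_one_mem_tailGroup b
    have hmX : m < F (F b - 1) :=
      (hmin w hw).trans_lt (huw.trans_le (h.mono (by have := hu.2.1; omega)))
    have hle : F (F b - 1) ≤ F (F b) := h.mono (by omega)
    have lt_X : ∀ v ∈ tailGroup F b, F v < F (F b - 1) → v < F b - 1 := by
      intro v hv hlt
      by_contra! hle
      exact absurd (h.mono hle) (not_le.2 hlt)
    have reach_mem : ∀ v, m < F v → F v < F (F b) → F v ∈ tailGroup F (F b) := fun v h1 h2 =>
      ⟨hm.1.trans h1, h2, hm.2.2.trans_le (h.mono h1.le)⟩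
    rcases hle.eq_or_lt with heq | hlt
    · refine Or.inl ⟨heq, fun v hv => ?_⟩
      by_contra! hcon
      obtain ⟨hne, w', hw', hlt'⟩ := hcon
      have hmv : m < F v := (hmin w' hw').trans_lt hlt'
      have hvlt : F v < F (F b) := (h.mono hv.2.1.le).lt_of_ne hne
      exact hpat b hb v hv _ hX m hm _ (reach_mem v hmv hvlt) (lt_X v hv (by omega)) hmv hmX le_rfl
        (iff_of_true hmv (by omega))
    · refine Or.inr ⟨hlt, fun v hv => ?_⟩
      by_contra hne
      have hvlt : F v < F (F b - 1) := (h.mono (by have := hv.2.1; omega)).lt_of_ne hne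
      by_cases hmv : m < F v
      · exact hpat b hb v hv _ hX m hm _ (reach_mem v hmv (hvlt.trans hlt)) (lt_X v hv hvlt) hmv
          hmX le_rfl (iff_of_true hmv hvlt)
      · have hX' := h.sub_one_mem_tailGroup (F b)
        exact hpat b hb v hv _ hX m hm _ hX' (lt_X v hv hvlt) (by omega) hmX (by omega)
          (iff_of_false hmv (by omega))
  -- Dependence on the earlier member passes to the next pair of groups.
  have row_step : ∀ b, F^[3] b = b + n →
      (∀ v ∈ tailGroup F b, F v = F (F b) ∨ ∀ w ∈ tailGroup F (F b), F v ≤ w) →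
      ∀ u ∈ tailGroup F (F b), ∀ w ∈ tailGroup F (F (F b)), w < F u →
      (F (F (F b) - 1) = F (F (F b)) ∧ ∀ v ∈ tailGroup F (F b),
        F v = F (F (F b)) ∨ ∀ w ∈ tailGroup F (F (F b)), F v ≤ w) ∧
      ∀ w ∈ tailGroup F (F (F b)), F (F (F b) - 2) ≤ w := by
    intro b hb hrow u hu w hw huw
    have hX := h.sub_one_mem_tailGroup (F b)
    have hY := h.sub_two_mem_tailGroup (F b)
    have hne : F (F (F b) - 2) ≠ F (F (F b) - 1) := by
      intro heq
      obtain ⟨v, hv⟩ := h.exists_reach_eq hred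
        (x := F (F b) - 1) (by rw [← heq]; congr 1; ring)
      rcases hrow v (h.mem_tailGroup_of_reach_eq hv) with h1 | h1
      · omega
      · have := h1 _ hY
        omega
    have hlt : F (F (F b) - 2) < F (F (F b) - 1) := (h.mono (by omega)).lt_of_ne hne
    rcases dichotomy (F b) (h.iterate_reach hb) u hu w hw huw with h1 | h1
    · refine ⟨h1, ?_⟩
      rcases h1.2 _ hY with h2 | h2
      · omega
      · exact h2
    · exact absurd (h1.2 _ hY) hne
  have parity : ∀ b, F^[3] b = b + n → ∀ x ∈ tailGroup F b, ∀ y ∈ tailGroup F (F b),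
      ∀ t ∈ tailGroup F (F (F b)), F t ≤ x + n → ¬ (y < F x ↔ F y ≤ t) := by
    intro b hb x hx y hy t ht htx hiff
    have key := h.sum_direct_eq_zero hperf le_rfl hb
      (fun i => if i = 0 then x else if i = 1 then y else if i = 2 then t else x + n) ?_ (by simp)
      (by
        rintro ⟨-, -, -, h3⟩
        norm_num at h3
        omega)
    · simp only [Finset.sum_range_succ, Finset.sum_range_zero] at key
      norm_num at key
      rw [if_neg (not_lt.2 htx)] at key
      split_ifs at key with k1 k2 k2
      · exact absurd (hiff.1 k1) (not_le.2 k2)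
      · exact absurd key (by decide)
      · exact absurd key (by decide)
      · exact k1 (hiff.2 (not_lt.1 k2))
    · intro i hi
      interval_cases i
      · simpa using hx
      · simpa using hy
      · simpa using ht
  -- The transversal of the last position of the first block and the last but one positions of the
  -- other two has exactly one direct transition.
  have row_false : ∀ b, F^[3] b = b + n →
      (F (F b - 1) = F (F b) ∧
        ∀ v ∈ tailGroup F b, F v = F (F b) ∨ ∀ w ∈ tailGroup F (F b), F v ≤ w) →
      ∀ u ∈ tailGroup F (F b), ∀ w ∈ tailGroup F (F (F b)), ∀ z ∈ tailGroup F (F (F (F b))),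
        w < F u → z < F w → False := by
    intro b hb hrow u hu w hw z hz huw hwz
    obtain ⟨h1, h2⟩ := row_step b hb hrow.2 u hu w hw huw
    obtain ⟨-, h3⟩ := row_step (F b) (h.iterate_reach hb) h1.2 w hw z hz hwz
    have hb' : F (F (F b)) = b + n := hb
    have hX : F b - 1 + n ∈ tailGroup F (F (F (F b))) := by
      have := h.add_mul_mem_tailGroup (h.sub_one_mem_tailGroup b) 1
      rwa [one_mul, ← hb'] at this
    refine parity b hb _ (h.sub_one_mem_tailGroup b) _ (h.sub_two_mem_tailGroup (F b)) _
      (h.sub_two_mem_tailGroup (F (F b))) (h3 _ hX) (iff_of_true ?_ ?_)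
    · rw [hrow.1]
      omega
    · exact h2 _ (h.sub_two_mem_tailGroup _)
  have ha' : F (F (F a)) = a + n := ha
  have hu' : u + n ∈ tailGroup F (F (F (F a))) := by
    have := h.add_mul_mem_tailGroup hu 1
    rwa [one_mul, ← ha'] at this
  have hw' : w + n ∈ tailGroup F (F (F (F (F a)))) := by
    have := h.add_mul_mem_tailGroup hw 1
    rwa [one_mul, ← h.shift, ← ha'] at this
  have huw' : w + n < F (u + n) := by rw [h.shift]; omega
  have ha₁ := h.iterate_reach ha
  have ha₂ := h.iterate_reach ha₁
  rcases dichotomy a ha u hu w hw huw with hr₀ | hc₀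
  · exact row_false a ha hr₀ w hw z hz _ hu' hwz hzu
  rcases dichotomy (F a) ha₁ w hw z hz hwz with hr₁ | hc₁
  · exact row_false (F a) ha₁ hr₁ z hz _ hu' _ hw' hzu huw'
  rcases dichotomy (F (F a)) ha₂ z hz _ hu' hzu with hr₂ | hc₂
  · have hz' : z + n ∈ tailGroup F (F (F (F (F (F a))))) := by
      have := h.add_mul_mem_tailGroup hz 1
      rwa [one_mul, ← h.shift, ← h.shift, ← ha'] at this
    exact row_false (F (F a)) ha₂ hr₂ _ hu' _ hw' _ hz' huw' (by rw [h.shift]; omega)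
  -- In the remaining case adjacency always depends on the later member only.
  have col_eq : ∀ b, F^[3] b = b + n → (∀ v ∈ tailGroup F b, F v = F (F b - 1)) →
      (∀ v ∈ tailGroup F (F b), F v = F (F (F b) - 1)) → F (F b - 1) = F (F b) - 1 := by
    intro b hb h1 h2
    obtain ⟨v, hv⟩ := h.exists_reach_eq hred (x := F (F b) - 1) (by
      rw [show F (F b) - 1 - 1 = F (F b) - 2 by ring]
      exact h2 _ (h.sub_two_mem_tailGroup _))
    rw [← h1 v (h.mem_tailGroup_of_reach_eq hv), hv]
  have e₀ := col_eq a ha hc₀.2 hc₁.2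
  have e₁ := col_eq (F a) ha₁ hc₁.2 hc₂.2
  have e₂ := hc₂.1
  rw [ha', h.shift] at e₂
  refine parity a ha _ (h.sub_one_mem_tailGroup a) _ (h.sub_one_mem_tailGroup (F a)) _
    (h.sub_two_mem_tailGroup (F (F a))) ?_ (iff_of_false ?_ ?_)
  · rw [hc₂.2 _ (h.sub_two_mem_tailGroup _), ha']
    omega
  · omega
  · omega

end IsReach

/-! ### The induced subgraphs `F₁`, `F₂`, `F₃` -/

/-- In a locally complete 2-edge-colouring two edges that form an induced path have different
colours. -/
theorem IsLocallyCompleteTwoEdgeColourable.exists_label {V : Type*} {G : SimpleGraph V}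
    (h : G.IsLocallyCompleteTwoEdgeColourable) :
    ∃ col : V → V → Fin 2, (∀ x y, col x y = col y x) ∧ ∀ x y z, G.Adj x y → G.Adj x z → y ≠ z →
      ¬ G.Adj y z → col x y ≠ col x z := by
  classical
  obtain ⟨φ, hφ⟩ := h
  refine ⟨fun x y => if hxy : G.Adj x y then φ.get x y hxy else 0, fun x y => ?_, ?_⟩
  · by_cases hxy : G.Adj x y
    · simp only
      rw [dif_pos hxy, dif_pos hxy.symm, EdgeLabeling.get_comm]
    · simp only
      rw [dif_neg hxy, dif_neg (fun h' => hxy h'.symm)]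
  · intro x y z hxy hxz hyz hn he
    simp only at he
    rw [dif_pos hxy, dif_pos hxz] at he
    refine hn (hφ x (φ.get x y hxy) ?_ ?_ hyz)
    · exact (EdgeLabeling.labelGraph_adj x y).2 ⟨hxy, rfl⟩
    · exact (EdgeLabeling.labelGraph_adj x z).2 ⟨hxz, he.symm⟩

instance : DecidableRel graphF1.Adj := fun _ _ => by unfold graphF1; infer_instance

instance : DecidableRel graphF2.Adj := fun _ _ => by unfold graphF2; infer_instance

instance : DecidableRel graphF3.Adj := fun _ _ => by unfold graphF3; infer_instance

theorem IsLocallyCompleteTwoEdgeColourable.of_isIndContained {V W : Type*} {G : SimpleGraph V}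
    {H : SimpleGraph W} (h : G.IsLocallyCompleteTwoEdgeColourable) (hHG : H.IsIndContained G) :
    H.IsLocallyCompleteTwoEdgeColourable := by
  obtain ⟨f⟩ := hHG
  obtain ⟨φ, hφ⟩ := h
  refine ⟨φ.pullback f.toHom, fun x c y hy z hz hyz => ?_⟩
  have key : ∀ y, ((φ.pullback f.toHom).labelGraph c).Adj x y →
      (φ.labelGraph c).Adj (f x) (f y) := by
    intro y hy
    rw [EdgeLabeling.labelGraph_adj] at hy ⊢
    obtain ⟨hxy, he⟩ := hy
    exact ⟨f.map_adj_iff.2 hxy, he⟩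
  exact f.map_adj_iff.1 (hφ (f x) c (key y hy) (key z hz) (fun e => hyz (f.injective e)))

/-- The edges `01, 12, 24, 45, 56, 35, 13` form a closed chain of seven, consecutive ones spanning
induced paths. -/
theorem graphF1_not_colourable : ¬ graphF1.IsLocallyCompleteTwoEdgeColourable := by
  intro h
  obtain ⟨col, hs, hc⟩ := h.exists_label
  have c₁ := hc 1 0 2 (by decide) (by decide) (by decide) (by decide)
  have c₂ := hc 2 1 4 (by decide) (by decide) (by decide) (by decide)
  have c₃ := hc 4 2 5 (by decide) (by decide) (by decide) (by decide)
  have c₄ := hc 5 4 6 (by decide) (by decide) (by decide) (by decide)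
  have c₅ := hc 5 6 3 (by decide) (by decide) (by decide) (by decide)
  have c₆ := hc 3 5 1 (by decide) (by decide) (by decide) (by decide)
  have c₇ := hc 1 3 0 (by decide) (by decide) (by decide) (by decide)
  rw [hs 2 1] at c₂
  rw [hs 4 2] at c₃
  rw [hs 5 4] at c₄
  rw [hs 3 5, hs 3 1] at c₆
  omega

/-- The edges `13, 34, 46, 24, 02, 23, 35` form a closed chain of seven, consecutive ones spanning
induced paths. -/
theorem graphF2_not_colourable : ¬ graphF2.IsLocallyCompleteTwoEdgeColourable := by
  intro h
  obtain ⟨col, hs, hc⟩ := h.exists_label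
  have c₁ := hc 3 1 4 (by decide) (by decide) (by decide) (by decide)
  have c₂ := hc 4 3 6 (by decide) (by decide) (by decide) (by decide)
  have c₃ := hc 4 6 2 (by decide) (by decide) (by decide) (by decide)
  have c₄ := hc 2 4 0 (by decide) (by decide) (by decide) (by decide)
  have c₅ := hc 2 0 3 (by decide) (by decide) (by decide) (by decide)
  have c₆ := hc 3 2 5 (by decide) (by decide) (by decide) (by decide)
  have c₇ := hc 3 5 1 (by decide) (by decide) (by decide) (by decide)
  rw [hs 4 3] at c₂
  rw [hs 2 4] at c₄
  rw [hs 3 2] at c₆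
  omega

/-- The edges `01, 14, 46, 24, 02, 25, 56, 35, 13` form a closed chain of nine, consecutive ones
spanning induced paths. -/
theorem graphF3_not_colourable : ¬ graphF3.IsLocallyCompleteTwoEdgeColourable := by
  intro h
  obtain ⟨col, hs, hc⟩ := h.exists_label
  have c₁ := hc 1 0 4 (by decide) (by decide) (by decide) (by decide)
  have c₂ := hc 4 1 6 (by decide) (by decide) (by decide) (by decide)
  have c₃ := hc 4 6 2 (by decide) (by decide) (by decide) (by decide)
  have c₄ := hc 2 4 0 (by decide) (by decide) (by decide) (by decide)
  have c₅ := hc 2 0 5 (by decide) (by decide) (by decide) (by decide)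
  have c₆ := hc 5 2 6 (by decide) (by decide) (by decide) (by decide)
  have c₇ := hc 5 6 3 (by decide) (by decide) (by decide) (by decide)
  have c₈ := hc 3 5 1 (by decide) (by decide) (by decide) (by decide)
  have c₉ := hc 1 3 0 (by decide) (by decide) (by decide) (by decide)
  rw [hs 4 1] at c₂
  rw [hs 2 4] at c₄
  rw [hs 5 2] at c₆
  rw [hs 3 5, hs 3 1] at c₈
  omega

namespace IsReach

variable {V : Type*} {G : SimpleGraph V} {n : ℕ} {p : ℤ → V} {F : ℤ → ℤ}

/-- A graph on `0, …, 6` whose adjacencies are those of an increasing sequence of seven positions,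
all within one turn, is an induced subgraph. -/
theorem isIndContained (h : G.IsReach n p F) {H : SimpleGraph (Fin 7)} (z : Fin 7 → ℤ)
    (hz : StrictMono z) (hlast : F (z 6) ≤ z 0 + n)
    (hH : ∀ i j, i < j → (H.Adj i j ↔ z j < F (z i))) : H.IsIndContained G := by
  have hlt : ∀ i j, z j < z i + n := fun i j => by
    have h1 := hz.monotone (Fin.zero_le i)
    have h2 := hz.monotone (Fin.le_last j)
    have h3 := h.lt_reach (z 6)
    change z j ≤ z 6 at h2
    omega
  have key : ∀ i j, i < j → (G.Adj (p (z i)) (p (z j)) ↔ H.Adj i j) := by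
    intro i j hij
    rw [hH i j hij, h.adj_iff _ _ (hz hij) (hlt i j)]
    refine or_iff_left ?_
    have h1 := hz.monotone (Fin.zero_le i)
    have h2 := h.mono (show z j ≤ z 6 from hz.monotone (Fin.le_last j))
    omega
  have hne : ∀ i j, i < j → p (z i) ≠ p (z j) := fun i j hij => h.ne_of_lt (hz hij) (hlt i j)
  refine ⟨⟨⟨fun i => p (z i), fun i j he => ?_⟩, fun {i j} => ?_⟩⟩
  · by_contra hij
    rcases lt_or_gt_of_ne hij with h' | h'
    · exact hne i j h' he
    · exact hne j i h' he.symm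
  · change G.Adj (p (z i)) (p (z j)) ↔ H.Adj i j
    rcases lt_trichotomy i j with h' | rfl | h'
    · exact key i j h'
    · simp
    · rw [G.adj_comm, H.adj_comm]
      exact key j i h'

/-- Two members `u < u'` of a final group and two members `q < r` of the next one with `u' ~ q`,
`u ≁ r` and both or none of `u ~ q`, `u' ~ r` span, with the first positions of the three blocks
concerned, a copy of `F₂` or of `F₃`. -/
theorem not_pattern (h : G.IsReach n p F) {k : ℕ} (hk : 3 ≤ k) (h₂ : ¬ graphF2.IsIndContained G)
    (h₃ : ¬ graphF3.IsIndContained G) {b : ℤ} (hb : F^[k] b = b + n) {u u' q r : ℤ}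
    (hu : u ∈ tailGroup F b) (hu' : u' ∈ tailGroup F b) (hq : q ∈ tailGroup F (F b))
    (hr : r ∈ tailGroup F (F b)) (huu : u < u') (hqr : q < r) (hqu : q < F u') (hur : F u ≤ r) :
    ¬ (q < F u ↔ r < F u') := by
  intro hiff
  obtain ⟨u1, u2, u3⟩ := hu
  obtain ⟨v1, v2, v3⟩ := hu'
  obtain ⟨q1, q2, q3⟩ := hq
  obtain ⟨r1, r2, r3⟩ := hr
  have hlast : F (F (F b)) ≤ b + n := by
    obtain ⟨j, rfl⟩ : ∃ j, k = j + 3 := ⟨k - 3, by omega⟩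
    rw [← hb]
    exact (h.iterate_strictMono b).monotone (show 3 ≤ j + 3 by omega)
  have e1 : F u ≤ F (F b) := h.mono u2.le
  have e2 : F u' ≤ F (F b) := h.mono v2.le
  have e3 := h.lt_reach (F (F b))
  have hmono : StrictMono ![b, u, u', F b, q, r, F (F b)] := by
    rw [Fin.strictMono_iff_lt_succ]
    intro i
    fin_cases i <;> simp <;> assumption
  by_cases hqF : q < F u
  · have hrF := hiff.1 hqF
    refine h₃ (h.isIndContained ![b, u, u', F b, q, r, F (F b)] hmono hlast fun i j hij => ?_)
    fin_cases i <;> fin_cases j <;>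
      first
      | exact absurd hij (by decide)
      | exact iff_of_true (by decide) (by simp <;> omega)
      | exact iff_of_false (by decide) (by simp <;> omega)
  · have hrF := fun hlt => hqF (hiff.2 hlt)
    refine h₂ (h.isIndContained ![b, u, u', F b, q, r, F (F b)] hmono hlast fun i j hij => ?_)
    fin_cases i <;> fin_cases j <;>
      first
      | exact absurd hij (by decide)
      | exact iff_of_true (by decide) (by simp <;> omega)
      | exact iff_of_false (by decide) (by simp <;> omega)

/-! ### The colouring -/

/-- If no position has neighbours in both of the blocks adjacent to its own, colouring the edges
inside the blocks with one colour and the edges between blocks with the other is locally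
complete. -/
theorem isLocallyCompleteTwoEdgeColourable (h : G.IsReach n p F) {a : ℤ} {k : ℕ} (hk : 3 ≤ k)
    (ha : F^[k] a = a + n)
    (hcross : ∀ b, F^[k] b = b + n → ∀ u ∈ tailGroup F b, ∀ w ∈ tailGroup F (F b), F u ≤ w) :
    G.IsLocallyCompleteTwoEdgeColourable := by
  classical
  have A_mono := h.iterate_strictMono a
  -- The index of the block of a vertex.
  have hblock : ∀ x, ∃ t i, t < k ∧ F^[t] a ≤ i ∧ i < F^[t + 1] a ∧ p i = x := by
    intro x
    obtain ⟨i, hi1, hi2, rfl⟩ := h.exists_lift a x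
    have hex : ∃ t : ℕ, i < F^[t] a := ⟨k, by rw [ha]; exact hi2⟩
    have hfind := Nat.find_spec hex
    have hle := Nat.find_min' hex (show i < F^[k] a by rw [ha]; exact hi2)
    obtain ⟨t, ht⟩ : ∃ t, Nat.find hex = t + 1 := by
      refine ⟨Nat.find hex - 1, ?_⟩
      have : Nat.find hex ≠ 0 := by
        intro h0
        rw [h0] at hfind
        exact absurd hi1 (not_le.2 hfind)
      omega
    rw [ht] at hfind
    exact ⟨t, i, by omega, not_lt.1 (Nat.find_min hex (by omega)), hfind, rfl⟩
  choose τ l hτ hl1 hl2 hl3 using hblock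
  have turn : ∀ t i, t < k → F^[t] a ≤ i → i < F^[t + 1] a → a ≤ i ∧ i < a + n := by
    intro t i ht h1 h2
    have h3 : F^[0] a ≤ F^[t] a := A_mono.monotone (Nat.zero_le t)
    have h4 : F^[t + 1] a ≤ F^[k] a := A_mono.monotone ht
    rw [ha] at h4
    exact ⟨h3.trans h1, h2.trans_le h4⟩
  have unique : ∀ t i, t < k → F^[t] a ≤ i → i < F^[t + 1] a → τ (p i) = t := by
    intro t i ht h1 h2
    have h3 := turn t i ht h1 h2
    have h4 := turn _ _ (hτ (p i)) (hl1 (p i)) (hl2 (p i))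
    have h5 : l (p i) = i := by
      rcases lt_trichotomy (l (p i)) i with hlt | heq | hlt
      · exact absurd (hl3 (p i)) (h.ne_of_lt hlt (by omega))
      · exact heq
      · exact absurd (hl3 (p i)).symm (h.ne_of_lt hlt (by omega))
    have h6 := hl1 (p i)
    have h7 := hl2 (p i)
    rw [h5] at h6 h7
    have h8 := A_mono.lt_iff_lt.1 (h6.trans_lt h2)
    have h9 := A_mono.lt_iff_lt.1 (h1.trans_lt h7)
    omega
  have hper : ∀ t : ℕ, F^[k] (F^[t] a) = F^[t] a + n := by
    intro t
    rw [← Function.iterate_add_apply, Nat.add_comm]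
    exact h.iterate_period_add ha t
  -- The neighbours of `x` in other blocks lie ahead of the block of `x` or behind it.
  have outside : ∀ x y, G.Adj x y → τ x ≠ τ y →
      (∃ j, p j = y ∧ F^[τ x + 1] a ≤ j ∧ j < F (l x)) ∨
        ∃ j, p j = y ∧ j < F^[τ x] a ∧ l x < F j := by
    intro x y hxy hne
    obtain ⟨j, hj1, hj2, rfl⟩ := h.exists_lift (l x) y
    have hlt : l x < j := by
      refine hj1.lt_of_ne fun e => ?_
      rw [← e, hl3] at hxy
      exact G.irrefl hxy
    rw [← hl3 x] at hxy
    rcases (h.adj_iff _ _ hlt hj2).1 hxy with h1 | h1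
    · refine Or.inl ⟨j, rfl, ?_, h1⟩
      by_contra! h2
      exact hne (unique _ j (hτ x) ((hl1 x).trans hj1) h2).symm
    · have e : p (j + (-1) * n) = p j := h.vertex_shift j (-1)
      refine Or.inr ⟨j + (-1) * n, e, ?_, by rw [h.shift_mul]; omega⟩
      by_contra! h2
      refine hne ?_
      rw [← e]
      exact (unique _ _ (hτ x) h2 (by have := hl2 x; omega)).symm
  have not_both : ∀ x j j', F^[τ x + 1] a ≤ j → j < F (l x) → j' < F^[τ x] a → l x < F j' →
      False := by
    intro x j j' h1 h2 h3 h4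
    obtain ⟨c, hc, hck⟩ := h.exists_prev hk (hper (τ x))
    have h5 := hl1 x
    have h6 := hl2 x
    rw [Function.iterate_succ_apply', ← hc] at h1 h6
    rw [← hc] at h3 h5
    have h7 : j' ∈ tailGroup F c := by
      refine ⟨?_, h3, by omega⟩
      by_contra! hle
      have := h.mono hle
      omega
    have h8 : l x ∈ tailGroup F (F c) := by
      refine ⟨?_, h6, by omega⟩
      by_contra! hle
      have := h.mono hle
      omega
    have := hcross c hck j' h7 _ h8
    omega
  refine ⟨EdgeLabeling.mk (fun x y _ => if τ x = τ y then 0 else 1)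
    (fun x y _ => by simp only [eq_comm]), fun x c y hy z hz hyz => ?_⟩
  rw [mem_neighborSet, EdgeLabeling.labelGraph_adj] at hy hz
  obtain ⟨hxy, hy⟩ := hy
  obtain ⟨hxz, hz⟩ := hz
  change (if τ x = τ y then 0 else 1) = c at hy
  change (if τ x = τ z then 0 else 1) = c at hz
  by_cases e₁ : τ x = τ y <;> by_cases e₂ : τ x = τ z
  · have block_adj : ∀ y z, τ y = τ z → l y < l z → G.Adj y z := by
      intro y z e hlt
      rw [← hl3 y, ← hl3 z]
      refine h.adj_of_lt hlt ((hl2 z).trans_le ?_)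
      rw [← e, Function.iterate_succ_apply']
      exact h.mono (hl1 y)
    rcases lt_trichotomy (l y) (l z) with h' | h' | h'
    · exact block_adj y z (e₁.symm.trans e₂) h'
    · exact absurd (by rw [← hl3 y, ← hl3 z, h']) hyz
    · exact (block_adj z y (e₂.symm.trans e₁) h').symm
  · rw [if_pos e₁] at hy
    rw [if_neg e₂, ← hy] at hz
    exact absurd hz (by decide)
  · rw [if_neg e₁] at hy
    rw [if_pos e₂, ← hy] at hz
    exact absurd hz (by decide)
  · have close : ∀ i j, (i < j → j < F i) → (j < i → i < F j) → p i ≠ p j → G.Adj (p i) (p j) := by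
      intro i j h1 h2 hne
      rcases lt_trichotomy i j with h' | rfl | h'
      · exact h.adj_of_lt h' (h1 h')
      · exact absurd rfl hne
      · exact (h.adj_of_lt h' (h2 h')).symm
    have hx := hl1 x
    have hx' := hl2 x
    rcases outside x y hxy e₁ with ⟨j, rfl, h1, h2⟩ | ⟨j, rfl, h1, h2⟩ <;>
      rcases outside x z hxz e₂ with ⟨j', rfl, h3, h4⟩ | ⟨j', rfl, h3, h4⟩
    · refine close j j' (fun _ => ?_) (fun _ => ?_) hyz
      · exact h4.trans_le (h.mono (by omega))
      · exact h2.trans_le (h.mono (by omega))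
    · exact (not_both x j j' h1 h2 h3 h4).elim
    · exact (not_both x j' j h3 h4 h1 h2).elim
    · exact close j j' (fun _ => by omega) (fun _ => by omega) hyz

end IsReach

end SimpleGraph

theorem mainTheorem6 {V : Type*} [Finite V] (G : SimpleGraph V)
    (hred : G.IsReduced) (hpca : G.IsProperCircularArc) (hpi : ¬ G.IsProperInterval)
    (hcc : 3 ≤ G.cliqueCoverNum)
    {n : ℕ} (v : ZMod n ≃ V) (hv : G.IsRoundOrdering v)
    (hpc : ∀ i : ZMod n, ¬ G.IsPseudoCutvertex v i)
    (hperf : G.IsPerfect) :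
    G.IsLocallyCompleteTwoEdgeColourable ↔
      ¬ SimpleGraph.graphF1.IsIndContained G ∧ ¬ SimpleGraph.graphF2.IsIndContained G ∧
        ¬ SimpleGraph.graphF3.IsIndContained G := by
  constructor
  · exact fun h => ⟨fun hF => SimpleGraph.graphF1_not_colourable (h.of_isIndContained hF),
      fun hF => SimpleGraph.graphF2_not_colourable (h.of_isIndContained hF),
      fun hF => SimpleGraph.graphF3_not_colourable (h.of_isIndContained hF)⟩
  · rintro ⟨-, h₂, h₃⟩
    obtain ⟨p, F, h⟩ := hv.exists_isReach hpca hcc (hperf.exists_indep_triple hcc) hpc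
    obtain ⟨a, k, hk, ha⟩ := h.exists_periodic hperf
    refine h.isLocallyCompleteTwoEdgeColourable hk ha fun b hb u hu w hw => ?_
    refine h.reach_le_of_no_triangle hred hperf hk ?_ hb hu hw
    rintro rfl b hb u hu w hw z hz huw hwz
    by_contra! hzu
    exact h.false_of_triangle hred hperf
      (fun b hb u hu u' hu' q hq r hr => h.not_pattern le_rfl h₂ h₃ hb hu hu' hq hr)
      hb hu hw hz huw hwz hzu
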